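/- Let $H=\mathbb C\times\mathbb R$ be the Heisenberg group, with the product topology and the group law $(z,t)(z',t')=\bigl(z+z',\,t+t'+\tfrac12\operatorname{Im}(\overline z z')\bigr)$; let $Z(H)$ be its centre, and let $p:H\to\mathbb C$, $p(z,t)=z$. For a locally compact group $G$, let $\mathcal C(G)$ be the space of closed subgroups of $G$ with the Chabauty topology, in which a basis of neighbourhoods of $C$ is given by the sets $\{D\in\mathcal C(G) : D\cap K\subset CU,\ C\cap K\subset DU\}$ with $K\subset G$ compact and $U$ an open neighbourhood of the identity. A lattice in $G$ is a discrete subgroup $\Lambda$ such that $G/\Lambda$ carries a $G$-invariant Borel probability measure. Let $\mathcal L(H)\subset\mathcal C(H)$ be the set of lattices in $H$; for $n\ge 1$ let $\mathcal L_n(H)$ be the set of those $\Lambda\in\mathcal L(H)$ for which $[\Lambda,\Lambda]$ has index $n$ in $\Lambda\cap Z(H)$; let $\mathcal L_\infty(H)$ be the set of the subgroups $p^{-1}(L)$, where $L$ is a lattice in $\mathbb C$; and let $\mathcal L_{!!}(H)=\mathcal L(H)\cup\mathcal L_\infty(H)$. (i) $\mathcal L(H)=\bigcup_{n\ge1}\mathcal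 L_n(H)$, and the frontier (topological boundary) of $\mathcal L(H)$ in $\mathcal C(H)$ contains $\mathcal L_\infty(H)$. (ii) The space $\mathcal C(H)$ is not locally connected. Indeed, no point $C\in\mathcal L_\infty(H)$ has a connected neighbourhood contained in $\mathcal L_{!!}(H)$. (iii) The subspaces $\mathcal L(H)$ and $\mathcal L_{!!}(H)$ are open and dense in $\mathcal C(H)$. (iv) The space $\mathcal C(H)$ is arc-connected, in the sense of path-connected: it is non-empty and any two of its points are joined by a continuous path. -/

import Mathlib

open Set Filter Topology
open scoped Pointwise

/-! ### The Chabauty topology on the space of closed subgroups -/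

section Chabauty

/-- The basic Chabauty neighbourhood of a closed subgroup `C`: the closed subgroups `D` with
`D ∩ K ⊆ C U` and `C ∩ K ⊆ D U`. -/
def chabautyNhd {G : Type*} [Group G] [TopologicalSpace G] (K U : Set G)
    (C : ClosedSubgroup G) : Set (ClosedSubgroup G) :=
  {D | (D : Set G) ∩ K ⊆ (C : Set G) * U ∧ (C : Set G) ∩ K ⊆ (D : Set G) * U}

/-- The Chabauty topology on the set of closed subgroups of `G`: a set is open when it
contains, around each of its points `C`, a set `chabautyNhd K U C` with `K` compact and `U` an open
neighbourhood of the identity. For locally compact `G` these sets form a basis of neighbourhoods,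
see `nhds_chabauty_hasBasis`. -/
instance chabautyTopology {G : Type*} [Group G] [TopologicalSpace G] :
    TopologicalSpace (ClosedSubgroup G) where
  IsOpen O := ∀ C ∈ O, ∃ K U : Set G, IsCompact K ∧ IsOpen U ∧ 1 ∈ U ∧ chabautyNhd K U C ⊆ O
  isOpen_univ := fun _ _ => ⟨∅, univ, isCompact_empty, isOpen_univ, mem_univ _, subset_univ _⟩
  isOpen_inter := by
    rintro O₁ O₂ h₁ h₂ C ⟨hC₁, hC₂⟩
    obtain ⟨K₁, U₁, hK₁, hU₁, h1₁, hV₁⟩ := h₁ C hC₁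
    obtain ⟨K₂, U₂, hK₂, hU₂, h1₂, hV₂⟩ := h₂ C hC₂
    refine ⟨K₁ ∪ K₂, U₁ ∩ U₂, hK₁.union hK₂, hU₁.inter hU₂, ⟨h1₁, h1₂⟩, fun D hD => ⟨hV₁ ?_, hV₂ ?_⟩⟩
    · exact ⟨fun x hx => mul_subset_mul_left inter_subset_left (hD.1 ⟨hx.1, Or.inl hx.2⟩),
        fun x hx => mul_subset_mul_left inter_subset_left (hD.2 ⟨hx.1, Or.inl hx.2⟩)⟩
    · exact ⟨fun x hx => mul_subset_mul_left inter_subset_right (hD.1 ⟨hx.1, Or.inr hx.2⟩),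
        fun x hx => mul_subset_mul_left inter_subset_right (hD.2 ⟨hx.1, Or.inr hx.2⟩)⟩
  isOpen_sUnion := by
    rintro S hS C ⟨O, hO, hC⟩
    obtain ⟨K, U, hK, hU, h1, hV⟩ := hS O hO C hC
    exact ⟨K, U, hK, hU, h1, hV.trans (subset_sUnion_of_mem hO)⟩

theorem mem_chabautyNhd_self {G : Type*} [Group G] [TopologicalSpace G] {K U : Set G}
    (h1 : (1 : G) ∈ U) (C : ClosedSubgroup G) : C ∈ chabautyNhd K U C :=
  ⟨fun x hx => ⟨x, hx.1, 1, h1, mul_one x⟩, fun x hx => ⟨x, hx.1, 1, h1, mul_one x⟩⟩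

/-- In a locally compact group, the sets `chabautyNhd K U C` form a basis of neighbourhoods of `C`
for the Chabauty topology. -/
theorem nhds_chabauty_hasBasis {G : Type*} [Group G] [TopologicalSpace G] [IsTopologicalGroup G]
    [LocallyCompactSpace G] (C : ClosedSubgroup G) :
    (𝓝 C).HasBasis (fun p : Set G × Set G => IsCompact p.1 ∧ IsOpen p.2 ∧ 1 ∈ p.2)
      (fun p => chabautyNhd p.1 p.2 C) := by
  have key : ∀ (K U : Set G), IsCompact K → IsOpen U → (1 : G) ∈ U →
      ∃ K₁ U₁ : Set G, IsCompact K₁ ∧ IsOpen U₁ ∧ (1 : G) ∈ U₁ ∧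
        ∀ A B D : ClosedSubgroup G, B ∈ chabautyNhd K₁ U₁ A → D ∈ chabautyNhd K₁ U₁ B →
          D ∈ chabautyNhd K U A := by
    intro K U hK hU h1
    obtain ⟨V, hVo, h1V, hVV⟩ := exists_open_nhds_one_mul_subset (hU.mem_nhds h1)
    obtain ⟨W, hW, hWV, hWc⟩ := local_compact_nhds (hVo.mem_nhds h1V)
    have h1W : (1 : G) ∈ W := mem_of_mem_nhds hW
    refine ⟨K * W⁻¹ ∪ K, interior W, (hK.mul hWc.inv).union hK, isOpen_interior,
      mem_interior_iff_mem_nhds.2 hW, ?_⟩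
    have aux : ∀ A B D : ClosedSubgroup G,
        (D : Set G) ∩ (K * W⁻¹ ∪ K) ⊆ (B : Set G) * interior W →
        (B : Set G) ∩ (K * W⁻¹ ∪ K) ⊆ (A : Set G) * interior W →
        (D : Set G) ∩ K ⊆ (A : Set G) * U := by
      rintro A B D h₁ h₂ x ⟨hxD, hxK⟩
      obtain ⟨b, hb, w, hw, rfl⟩ := h₁ ⟨hxD, Or.inr hxK⟩
      have hw' := interior_subset hw
      obtain ⟨a, ha, v, hv, hav⟩ := h₂ (a := b)
        ⟨hb, Or.inl ⟨b * w, hxK, w⁻¹, Set.inv_mem_inv.2 hw', by simp⟩⟩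
      refine ⟨a, ha, v * w, hVV ⟨v, hWV (interior_subset hv), w, hWV hw', rfl⟩, ?_⟩
      simp only at hav ⊢
      rw [← mul_assoc, hav]
    exact fun A B D hB hD => ⟨aux A B D hD.1 hB.1, aux D B A hB.2 hD.2⟩
  refine ⟨fun t => ?_⟩
  rw [mem_nhds_iff]
  constructor
  · rintro ⟨O, hOt, hO, hC⟩
    obtain ⟨K, U, hK, hU, h1, hV⟩ := hO C hC
    exact ⟨(K, U), ⟨hK, hU, h1⟩, hV.trans hOt⟩
  · rintro ⟨⟨K, U⟩, ⟨hK, hU, h1⟩, hV⟩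
    refine ⟨{D | ∃ K' U' : Set G, IsCompact K' ∧ IsOpen U' ∧ 1 ∈ U' ∧
      chabautyNhd K' U' D ⊆ chabautyNhd K U C}, ?_, ?_, K, U, hK, hU, h1, Subset.rfl⟩
    · rintro D ⟨K', U', _, _, h1', hD⟩
      exact hV (hD (mem_chabautyNhd_self h1' D))
    · rintro D ⟨K', U', hK', hU', h1', hD⟩
      obtain ⟨K₁, U₁, hK₁, hU₁, h1₁, hk⟩ := key K' U' hK' hU' h1'
      exact ⟨K₁, U₁, hK₁, hU₁, h1₁, fun B hB =>
        ⟨K₁, U₁, hK₁, hU₁, h1₁, fun E hE => hD (hk D B E hB hE)⟩⟩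

end Chabauty

/-! ### Lattices -/

/-- A lattice in a topological group `G` is a discrete subgroup `Λ` such that there is a
`G`-invariant Borel probability measure on `G / Λ`. -/
def IsGroupLattice {G : Type*} [Group G] [TopologicalSpace G] (Λ : Subgroup G) : Prop :=
  DiscreteTopology Λ ∧
    letI : MeasurableSpace (G ⧸ Λ) := borel (G ⧸ Λ)
    ∃ μ : MeasureTheory.Measure (G ⧸ Λ),
      MeasureTheory.IsProbabilityMeasure μ ∧ MeasureTheory.SMulInvariantMeasure G (G ⧸ Λ) μ

/-! ### The Heisenberg group -/

/-- The underlying set `ℂ × ℝ` of the Heisenberg group. -/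
@[ext]
structure Heisenberg where
  z : ℂ
  t : ℝ

namespace Heisenberg

/-- The product is `(z, t) (z', t') = (z + z', t + t' + Im (conj z * z') / 2)`. -/
noncomputable instance : Mul Heisenberg :=
  ⟨fun a b => ⟨a.z + b.z, a.t + b.t + (1 / 2) * ((starRingEnd ℂ) a.z * b.z).im⟩⟩

instance : One Heisenberg := ⟨⟨0, 0⟩⟩

instance : Inv Heisenberg := ⟨fun a => ⟨-a.z, -a.t⟩⟩

@[simp] theorem mul_z (a b : Heisenberg) : (a * b).z = a.z + b.z := rfl
@[simp] theorem mul_t (a b : Heisenberg) :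
    (a * b).t = a.t + b.t + (1 / 2) * ((starRingEnd ℂ) a.z * b.z).im := rfl
@[simp] theorem one_z : (1 : Heisenberg).z = 0 := rfl
@[simp] theorem one_t : (1 : Heisenberg).t = 0 := rfl
@[simp] theorem inv_z (a : Heisenberg) : (a⁻¹).z = -a.z := rfl
@[simp] theorem inv_t (a : Heisenberg) : (a⁻¹).t = -a.t := rfl

noncomputable instance : Group Heisenberg :=
  Group.ofLeftAxioms
    (fun a b c => by
      ext <;> simp <;> ring)
    (fun a => by ext <;> simp)
    (fun a => by
      ext <;> simp
      ring)

/-- The topology is the product topology of `ℂ × ℝ`. -/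
noncomputable instance : TopologicalSpace Heisenberg :=
  TopologicalSpace.induced (fun a : Heisenberg => (a.z, a.t)) inferInstance

/-- The projection `(z, t) ↦ z` onto the additive group `ℂ` (written multiplicatively). -/
noncomputable def p : Heisenberg →* Multiplicative ℂ where
  toFun a := Multiplicative.ofAdd a.z
  map_one' := rfl
  map_mul' _ _ := rfl

/-- The set `𝓛(H)` of lattices, inside the space `𝓒(H)` of closed subgroups. -/
def lattices : Set (ClosedSubgroup Heisenberg) :=
  {C | IsGroupLattice C.toSubgroup}

/-- The set `𝓛ₙ(H)` of the lattices `Λ` such that `[Λ, Λ]` has index `n` in `Λ ∩ Z(H)`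
(used for `n ≥ 1`). -/
def latticesOfIndex (n : ℕ) : Set (ClosedSubgroup Heisenberg) :=
  {C | C ∈ lattices ∧
    (⁅C.toSubgroup, C.toSubgroup⁆).relIndex
      (C.toSubgroup ⊓ Subgroup.center Heisenberg) = n}

/-- The set `𝓛_∞(H)` of the subgroups `p⁻¹(L)` with `L` a lattice in `ℂ`. -/
def latticesInfty : Set (ClosedSubgroup Heisenberg) :=
  {C | ∃ L : Subgroup (Multiplicative ℂ), IsGroupLattice L ∧ C.toSubgroup = L.comap p}

/-- The set `𝓛_!!(H) = 𝓛(H) ∪ 𝓛_∞(H)`. -/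
def latticesBangBang : Set (ClosedSubgroup Heisenberg) :=
  lattices ∪ latticesInfty

end Heisenberg

/-! Two invariants of a closed subgroup `D` control everything: its projection to the plane, and its
intersection with the centre, recorded by `centralPart`. They interact because the commutator of `a`
and `b` is the central element with coordinate `area a.z b.z`. If the projection does not lie in a
line, the central part is therefore nonzero. If the central part is also not all of `ℝ`, it is
cyclic; an element with short projection then has trivial commutators with two independent elements,
so the projection is discrete, and an explicit cell of finite volume shows that `D` is a lattice.
Conversely, a lattice is not contained in the kernel of a continuous homomorphism onto `ℝ`, since
`ℝ` has no invariant probability measure. This is `mem_lattices_iff`. It leaves two kinds of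
subgroups besides lattices: those containing the centre, which are preimages of closed subgroups of
the plane (`exists_eq_tube`), and those projecting into a line, which live in a copy of `ℝ × ℝ`
(`exists_eq_strip`).

Openness: being in `latticesBangBang` means having a plane basis. A nearby subgroup contains
elements close to the basis vectors and avoids a compact region of intermediate coordinates; a
doubling argument then excludes any further projections (`IsPlaneBasis.eventually`).

Local connectedness: for a lattice, `|area a.z b.z|` is an integral multiple `k * c` of the
generator `c` of the central part. The integer `k` is locally constant (`isOpen_stratum`), but near
a point of `latticesInfty` the area stays bounded below while `c` tends to zero, so every fixed `k`
is eventually avoided (`compl_stratum_mem_nhds`). Since lattices accumulate there, each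
neighbourhood inside `latticesBangBang` is split by a stratum.

Density: a preimage of a plane lattice is the limit of lattices with finer and finer centre. A
subgroup over a line is first approximated by a planar lattice with commensurable first coordinates;
adjoining a transverse element that goes to infinity then gives lattices converging to it.

Paths: closed subgroups of a plane are grids with spacings in `[0, ∞]`, and moving the spacings to
`∞` contracts strips to the trivial subgroup and tubes to the centre. Lattices are contracted by
dilations. -/

/-- Convergence of a family of subsets in the sense of Fell: every point of the limit is
approached, and every point outside of the limit has a neighbourhood that is eventually avoided. -/
def FellTendsto {ι X : Type*} [TopologicalSpace X] (F : ι → Set X) (l : Filter ι) (E : Set X) :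
    Prop :=
  (∀ x ∈ E, ∀ O ∈ 𝓝 x, ∀ᶠ i in l, (F i ∩ O).Nonempty) ∧
    ∀ x ∉ E, ∃ O ∈ 𝓝 x, ∀ᶠ i in l, Disjoint (F i) O

namespace FellTendsto

variable {ι X Y : Type*} [TopologicalSpace X] [TopologicalSpace Y] {l : Filter ι}

theorem congr' {F F' : ι → Set X} {E : Set X} (h : FellTendsto F l E) (hF : F =ᶠ[l] F') :
    FellTendsto F' l E := by
  refine ⟨fun x hx O hO => ?_, fun x hx => ?_⟩
  · filter_upwards [h.1 x hx O hO, hF] with i hi hi'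
    rwa [← hi']
  · obtain ⟨O, hO, h'⟩ := h.2 x hx
    refine ⟨O, hO, ?_⟩
    filter_upwards [h', hF] with i hi hi'
    rwa [← hi']

theorem pi {κ : Type*} [Finite κ] {X : κ → Type*} [∀ k, TopologicalSpace (X k)]
    {F : ι → ∀ k, Set (X k)} {E : ∀ k, Set (X k)} (h : ∀ k, FellTendsto (fun i => F i k) l (E k)) :
    FellTendsto (fun i => Set.pi univ (F i)) l (Set.pi univ E) := by
  refine ⟨fun x hx O hO => ?_, fun x hx => ?_⟩
  · rw [nhds_pi, Filter.mem_pi'] at hO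
    obtain ⟨I, t, ht, hO⟩ := hO
    have := fun k => (h k).1 (x k) (hx k (mem_univ _)) (t k) (ht k)
    filter_upwards [eventually_all.2 this] with i hi
    choose y hy using hi
    exact ⟨y, fun k _ => (hy k).1, hO fun k _ => (hy k).2⟩
  · simp only [Set.mem_pi, mem_univ, true_implies, not_forall] at hx
    obtain ⟨k, hk⟩ := hx
    obtain ⟨O, hO, h'⟩ := (h k).2 (x k) hk
    refine ⟨(fun y => y k) ⁻¹' O, (continuous_apply k).continuousAt hO, ?_⟩
    filter_upwards [h'] with i hi
    exact Set.disjoint_left.2 fun y hy hyO => Set.disjoint_left.1 hi (hy k (mem_univ _)) hyO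

/-- Openness of `f` is what lets points of the limit be approached; continuity suffices for
avoidance. -/
theorem preimage {F : ι → Set Y} {E : Set Y} (h : FellTendsto F l E) {f : X → Y}
    (hf : Continuous f) (hfo : IsOpenMap f) :
    FellTendsto (fun i => f ⁻¹' F i) l (f ⁻¹' E) := by
  refine ⟨fun x hx O hO => ?_, fun x hx => ?_⟩
  · filter_upwards [h.1 (f x) hx (f '' O) (hfo.image_mem_nhds hO)] with i hi
    obtain ⟨_, hy, y, hyO, rfl⟩ := hi
    exact ⟨y, hy, hyO⟩
  · obtain ⟨O, hO, h'⟩ := h.2 (f x) hx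
    refine ⟨f ⁻¹' O, hf.continuousAt hO, ?_⟩
    filter_upwards [h'] with i hi
    exact hi.preimage f

theorem image {F : ι → Set X} {E : Set X} (h : FellTendsto F l E) {f : X → Y}
    (hf : IsClosedEmbedding f) :
    FellTendsto (fun i => f '' F i) l (f '' E) := by
  refine ⟨?_, fun y hy => ?_⟩
  · rintro _ ⟨x, hx, rfl⟩ O hO
    filter_upwards [h.1 x hx _ (hf.continuous.continuousAt hO)] with i ⟨z, hz, hzO⟩
    exact ⟨f z, mem_image_of_mem f hz, hzO⟩
  · by_cases hy' : y ∈ range f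
    · obtain ⟨x, rfl⟩ := hy'
      obtain ⟨O, hO, h'⟩ := h.2 x fun hx => hy (mem_image_of_mem f hx)
      rw [hf.isInducing.nhds_eq_comap, mem_comap] at hO
      obtain ⟨O', hO', hOO'⟩ := hO
      refine ⟨O', hO', ?_⟩
      filter_upwards [h'] with i hi
      refine Set.disjoint_left.2 ?_
      rintro _ ⟨z, hz, rfl⟩ hzO
      exact Set.disjoint_left.1 hi hz (hOO' hzO)
    · refine ⟨(range f)ᶜ, hf.isClosed_range.isOpen_compl.mem_nhds hy', Eventually.of_forall fun i => ?_⟩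
      exact disjoint_compl_right.mono_left (image_subset_range f _)

/-- Preimages of a fixed closed set under invertible maps `θ i` that converge, together with their
inverses, locally uniformly. -/
theorem preimage_of_tendsto {S : Set Y} (hS : IsClosed S) {θ : ι → X → Y} {θ' : ι → Y → X}
    {φ : X → Y} {φ' : Y → X} (hθθ' : ∀ᶠ i in l, ∀ y, θ i (θ' i y) = y) (hφ : ∀ x, φ' (φ x) = x)
    (hθ : ∀ x, Tendsto (fun q : ι × X => θ q.1 q.2) (l ×ˢ 𝓝 x) (𝓝 (φ x)))
    (hθ' : ∀ y, Tendsto (fun i => θ' i y) l (𝓝 (φ' y))) :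
    FellTendsto (fun i => θ i ⁻¹' S) l (φ ⁻¹' S) := by
  refine ⟨fun x hx O hO => ?_, fun x hx => ?_⟩
  · have := hθ' (φ x)
    rw [hφ] at this
    filter_upwards [this hO, hθθ'] with i hi hi'
    exact ⟨θ' i (φ x), by rw [Set.mem_preimage, hi']; exact hx, hi⟩
  · have := hθ x (hS.isOpen_compl.mem_nhds hx)
    obtain ⟨A, hA, O, hO, h⟩ := Filter.mem_prod_iff.1 (Filter.mem_map.1 this)
    refine ⟨O, hO, ?_⟩
    filter_upwards [hA] with i hi
    exact Set.disjoint_left.2 fun y hy hyO => h (Set.mk_mem_prod hi hyO) hy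

end FellTendsto

/-! ### Chabauty neighbourhoods and Fell convergence -/

section Chabauty

variable {G : Type*} [Group G] [TopologicalSpace G] [IsTopologicalGroup G] [LocallyCompactSpace G]

/-- If `D` is close to `C`, then `D` has points close to a given point of `C`. -/
theorem ClosedSubgroup.eventually_inter_nonempty {C : ClosedSubgroup G} {x : G} (hx : x ∈ (C : Set G))
    {O : Set G} (hO : O ∈ 𝓝 x) : ∀ᶠ D : ClosedSubgroup G in 𝓝 C, ((D : Set G) ∩ O).Nonempty := by
  have hc : Tendsto (fun u : G => x * u⁻¹) (𝓝 1) (𝓝 x) := by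
    have : Continuous fun u : G => x * u⁻¹ := by fun_prop
    simpa using this.tendsto 1
  obtain ⟨U, hU, hUo, h1⟩ := mem_nhds_iff.1 (hc hO)
  refine (nhds_chabauty_hasBasis C).mem_iff.2 ⟨({x}, U), ⟨isCompact_singleton, hUo, h1⟩, ?_⟩
  rintro D ⟨-, hD⟩
  obtain ⟨d, hd, u, hu, hdu⟩ := hD ⟨hx, rfl⟩
  refine ⟨d, hd, ?_⟩
  have : d = x * u⁻¹ := eq_mul_inv_of_mul_eq hdu
  rw [this]
  exact hU hu

/-- If `D` is close to `C`, then `D` avoids a given compact set that `C` avoids. -/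
theorem ClosedSubgroup.eventually_disjoint {C : ClosedSubgroup G} {K : Set G} (hK : IsCompact K)
    (hCK : Disjoint (C : Set G) K) : ∀ᶠ D : ClosedSubgroup G in 𝓝 C, Disjoint (D : Set G) K := by
  have ho : IsOpen {q : G × G | q.1 * q.2⁻¹ ∉ (C : Set G)} :=
    C.isClosed'.isOpen_compl.preimage (by fun_prop : Continuous fun q : G × G => q.1 * q.2⁻¹)
  -- By compactness, one `U` works for all of `K`: no `x * u⁻¹` with `x ∈ K`, `u ∈ U` lies in `C`.
  obtain ⟨A, U, -, hU, hKA, h1, hAU⟩ := generalized_tube_lemma hK isCompact_singleton (t := {(1 : G)}) ho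
    (by
      rintro ⟨x, u⟩ ⟨hx, hu⟩
      rw [mem_singleton_iff] at hu
      simp only at hu hx
      subst hu
      simpa using fun h => Set.disjoint_left.1 hCK h hx)
  refine (nhds_chabauty_hasBasis C).mem_iff.2 ⟨(K, U), ⟨hK, hU, h1 rfl⟩, ?_⟩
  rintro D ⟨hD, -⟩
  refine Set.disjoint_left.2 fun x hxD hxK => ?_
  obtain ⟨c, hc, u, hu, hcu⟩ := hD ⟨hxD, hxK⟩
  refine hAU (Set.mk_mem_prod (hKA hxK) hu) ?_
  rwa [← eq_mul_inv_of_mul_eq hcu]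

/-- Convergence in the sense of Fell implies convergence for the Chabauty topology. -/
theorem FellTendsto.tendsto_closedSubgroup {ι : Type*} {l : Filter ι} {F : ι → ClosedSubgroup G}
    {C : ClosedSubgroup G} (h : FellTendsto (fun i => (F i : Set G)) l C) :
    Tendsto F l (𝓝 C) := by
  refine (nhds_chabauty_hasBasis C).tendsto_right_iff.2 ?_
  rintro ⟨K, U⟩ ⟨hK, hU, h1⟩
  have h₁ : ∀ᶠ i in l, (F i : Set G) ∩ K ⊆ (C : Set G) * U := by
    -- Both Chabauty inclusions are local on `K`, so compactness reduces them to a neighbourhood of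
    -- one point.
    refine hK.induction_on (p := fun S => ∀ᶠ i in l, (F i : Set G) ∩ S ⊆ (C : Set G) * U) ?_ ?_ ?_ ?_
    · simp
    · intro s t hst ht
      filter_upwards [ht] with i hi
      exact (inter_subset_inter_right _ hst).trans hi
    · intro s t hs ht
      filter_upwards [hs, ht] with i hi hi'
      rw [inter_union_distrib_left]
      exact union_subset hi hi'
    · intro x _
      by_cases hx : x ∈ (C : Set G)
      · refine ⟨(C : Set G) * U, mem_nhdsWithin_of_mem_nhds ?_, Eventually.of_forall fun i => inter_subset_right⟩
        exact (hU.mul_left).mem_nhds ⟨x, hx, 1, h1, mul_one x⟩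
      · obtain ⟨O, hO, h'⟩ := h.2 x hx
        refine ⟨O, mem_nhdsWithin_of_mem_nhds hO, ?_⟩
        filter_upwards [h'] with i hi
        rw [hi.inter_eq]
        exact empty_subset _
  have h₂ : ∀ᶠ i in l, (C : Set G) ∩ K ⊆ (F i : Set G) * U := by
    refine (hK.inter_left C.isClosed').induction_on
      (p := fun S => ∀ᶠ i in l, S ⊆ (F i : Set G) * U) ?_ ?_ ?_ ?_
    · simp
    · intro s t hst ht
      filter_upwards [ht] with i hi
      exact hst.trans hi
    · intro s t hs ht
      filter_upwards [hs, ht] with i hi hi'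
      exact union_subset hi hi'
    · rintro x ⟨hx, -⟩
      have hc : Tendsto (fun q : G × G => q.1⁻¹ * q.2) (𝓝 (x, x)) (𝓝 1) := by
        have : Continuous fun q : G × G => q.1⁻¹ * q.2 := by fun_prop
        simpa using this.tendsto (x, x)
      have := hc (hU.mem_nhds h1)
      rw [nhds_prod_eq, Filter.mem_map] at this
      obtain ⟨O, hO, h'⟩ := Filter.mem_prod_same_iff.1 this
      refine ⟨O, mem_nhdsWithin_of_mem_nhds hO, ?_⟩
      filter_upwards [h.1 x hx O hO] with i ⟨d, hd, hdO⟩ y hy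
      exact ⟨d, hd, d⁻¹ * y, h' (Set.mk_mem_prod hdO hy), mul_inv_cancel_left d y⟩
  filter_upwards [h₁, h₂] with i hi hi'
  exact ⟨hi, hi'⟩

end Chabauty

/-! ### Closed subgroups of the line -/

open scoped ENNReal

/-- The closed subgroup of `ℝ` with spacing `c`: it is `ℝ` for `c = 0`, it is `{0}` for `c = ∞`,
and it is generated by `c` otherwise. -/
noncomputable def spacedSubgroup (c : ℝ≥0∞) : AddSubgroup ℝ :=
  if c = 0 then ⊤ else AddSubgroup.zmultiples c.toReal

theorem spacedSubgroup_zero : spacedSubgroup 0 = ⊤ := if_pos rfl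

theorem spacedSubgroup_top : spacedSubgroup ⊤ = ⊥ := by
  simp [spacedSubgroup]

/-- This includes `c = ⊤`: there `c.toReal = 0`, and the only multiple is `0`. -/
theorem mem_spacedSubgroup_of_ne_zero {c : ℝ≥0∞} (hc : c ≠ 0) {x : ℝ} :
    x ∈ spacedSubgroup c ↔ ∃ n : ℤ, n * c.toReal = x := by
  simp [spacedSubgroup, hc, AddSubgroup.mem_zmultiples_iff]

theorem mem_spacedSubgroup_ofReal {c : ℝ} (hc : 0 < c) {x : ℝ} :
    x ∈ spacedSubgroup (ENNReal.ofReal c) ↔ ∃ n : ℤ, n * c = x := by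
  rw [mem_spacedSubgroup_of_ne_zero (by simpa using hc), ENNReal.toReal_ofReal hc.le]

theorem mem_spacedSubgroup_one {x : ℝ} : x ∈ spacedSubgroup 1 ↔ ∃ n : ℤ, (n : ℝ) = x := by
  simp [mem_spacedSubgroup_of_ne_zero]

theorem isClosed_spacedSubgroup (c : ℝ≥0∞) : IsClosed (spacedSubgroup c : Set ℝ) := by
  rw [spacedSubgroup]
  split_ifs
  · exact isClosed_univ
  · exact AddSubgroup.isClosed_of_discrete

theorem exists_eq_spacedSubgroup {T : AddSubgroup ℝ} (hT : IsClosed (T : Set ℝ)) :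
    ∃ c, T = spacedSubgroup c := by
  rcases T.dense_or_cyclic with h | ⟨a, ha⟩
  · refine ⟨0, ?_⟩
    rw [spacedSubgroup_zero, ← AddSubgroup.coe_eq_univ, ← hT.closure_eq, h.closure_eq]
  · rw [← AddSubgroup.zmultiples_eq_closure] at ha
    rcases eq_or_ne a 0 with rfl | h0
    · exact ⟨⊤, by simp [ha, spacedSubgroup_top]⟩
    · refine ⟨ENNReal.ofReal |a|, ?_⟩
      ext x
      rw [mem_spacedSubgroup_ofReal (abs_pos.2 h0), ha, AddSubgroup.mem_zmultiples_iff]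
      rcases abs_choice a with h | h
      · simp [h]
      · rw [h]
        constructor
        · rintro ⟨n, rfl⟩
          exact ⟨-n, by simp⟩
        · rintro ⟨n, rfl⟩
          exact ⟨-n, by simp⟩

theorem exists_abs_sub_lt_of_mem_spacedSubgroup {c : ℝ≥0∞} {ε : ℝ} (hc : c < ENNReal.ofReal ε)
    (x : ℝ) : ∃ y ∈ spacedSubgroup c, |y - x| < ε := by
  have hε : 0 < ε := by
    by_contra! h
    simp [ENNReal.ofReal_of_nonpos h] at hc
  rcases eq_or_ne c 0 with rfl | h0
  · exact ⟨x, by simp [spacedSubgroup_zero], by simpa⟩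
  · have hc' : c.toReal < ε := ENNReal.toReal_lt_of_lt_ofReal hc
    have hpos : 0 < c.toReal := ENNReal.toReal_pos h0 (hc.trans_le le_top).ne
    refine ⟨⌊x / c.toReal⌋ * c.toReal, (mem_spacedSubgroup_of_ne_zero h0).2 ⟨_, rfl⟩, ?_⟩
    have h1 := Int.floor_le (x / c.toReal)
    have h2 := Int.lt_floor_add_one (x / c.toReal)
    rw [le_div_iff₀ hpos] at h1
    rw [div_lt_iff₀ hpos] at h2
    rw [abs_lt]
    constructor <;> linarith

/-- Continuity of the parametrisation, in three regimes: small spacings fill the line, large ones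
push every nonzero multiple to infinity, and in between the subgroups are rescalings of `ℤ`. The
compact parameter space `[0, ∞]` later serves for both density and paths. -/
theorem fellTendsto_spacedSubgroup (c : ℝ≥0∞) :
    FellTendsto (fun c => (spacedSubgroup c : Set ℝ)) (𝓝 c) (spacedSubgroup c) := by
  rcases eq_or_ne c 0 with rfl | h0
  · refine ⟨fun x _ O hO => ?_, fun x hx => (hx (by simp [spacedSubgroup_zero])).elim⟩
    obtain ⟨ε, hε, hO⟩ := Metric.mem_nhds_iff.1 hO
    filter_upwards [gt_mem_nhds (ENNReal.ofReal_pos.2 hε)] with c hc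
    obtain ⟨y, hy, h⟩ := exists_abs_sub_lt_of_mem_spacedSubgroup hc x
    exact ⟨y, hy, hO (by simpa [Real.dist_eq] using h)⟩
  rcases eq_or_ne c ⊤ with rfl | h1
  · rw [spacedSubgroup_top]
    refine ⟨fun x hx O hO => Eventually.of_forall fun c => ⟨0, zero_mem _, ?_⟩, fun x hx => ?_⟩
    · rw [AddSubgroup.mem_bot.1 hx] at hO
      exact mem_of_mem_nhds hO
    · have hx0 : x ≠ 0 := hx
      refine ⟨{y | 0 < |y| ∧ |y| < |x| + 1}, ?_, ?_⟩
      · have ho : IsOpen {y : ℝ | 0 < |y| ∧ |y| < |x| + 1} :=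
          (isOpen_lt continuous_const continuous_abs).and (isOpen_lt continuous_abs continuous_const)
        exact ho.mem_nhds ⟨abs_pos.2 hx0, by simp⟩
      · filter_upwards [lt_mem_nhds (ENNReal.ofReal_lt_top (r := |x| + 1))] with c hc
        refine Set.disjoint_left.2 fun y hy hyO => ?_
        obtain ⟨n, rfl⟩ := (mem_spacedSubgroup_of_ne_zero (ne_bot_of_gt hc)).1 hy
        rcases eq_or_ne c ⊤ with rfl | hc1
        · simp at hyO
        have hc' : |x| + 1 < c.toReal := (ENNReal.ofReal_lt_iff_lt_toReal (by positivity) hc1).1 hc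
        have hn : n ≠ 0 := by
          rintro rfl
          simp at hyO
        have h1 : (1 : ℝ) ≤ |(n : ℝ)| := by exact_mod_cast Int.one_le_abs hn
        have h2 := hyO.2
        rw [abs_mul, abs_of_pos (show 0 < c.toReal by linarith [abs_nonneg x])] at h2
        nlinarith [abs_nonneg x]
  · have hpos : 0 < c.toReal := ENNReal.toReal_pos h0 h1
    have ht : Tendsto ENNReal.toReal (𝓝 c) (𝓝 c.toReal) := ENNReal.tendsto_toReal h1
    have hS : IsClosed (range ((↑) : ℤ → ℝ)) := Int.isClosedEmbedding_coe_real.isClosed_range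
    have key : ∀ d : ℝ≥0∞, d ≠ 0 → d ≠ ⊤ →
        (fun x : ℝ => x / d.toReal) ⁻¹' range ((↑) : ℤ → ℝ) = spacedSubgroup d := by
      intro d hd0 hd1
      ext x
      have := (ENNReal.toReal_pos hd0 hd1).ne'
      simp only [Set.mem_preimage, mem_range, SetLike.mem_coe, mem_spacedSubgroup_of_ne_zero hd0,
        eq_div_iff this]
    have hev : ∀ᶠ d : ℝ≥0∞ in 𝓝 c, d ≠ 0 ∧ d ≠ ⊤ :=
      (eventually_ne_nhds h0).and (eventually_ne_nhds h1)
    rw [← key c h0 h1]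
    refine FellTendsto.congr' (FellTendsto.preimage_of_tendsto hS (θ := fun d x => x / d.toReal)
      (θ' := fun d x => x * d.toReal) (φ' := fun x => x * c.toReal) ?_ ?_ ?_ ?_) ?_
    · filter_upwards [hev] with d hd y
      exact mul_div_cancel_right₀ y (ENNReal.toReal_pos hd.1 hd.2).ne'
    · exact fun x => div_mul_cancel₀ x hpos.ne'
    · exact fun x => tendsto_snd.div (ht.comp tendsto_fst) hpos.ne'
    · exact fun y => ht.const_mul y
    · filter_upwards [hev] with d hd
      exact key d hd.1 hd.2

/-! ### Closed subgroups of a real plane -/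

section Structure

open Module

variable {V : Type*} [NormedAddCommGroup V] [NormedSpace ℝ V]

/-- A closed subgroup of a finite-dimensional space that has arbitrarily short nonzero vectors
contains a line. -/
theorem exists_line_of_short [FiniteDimensional ℝ V] {E : AddSubgroup V} (hE : IsClosed (E : Set V))
    (h : ∀ ε > 0, ∃ x ∈ E, x ≠ 0 ∧ ‖x‖ < ε) : ∃ u : V, u ≠ 0 ∧ ∀ r : ℝ, r • u ∈ E := by
  choose! x hxE hx0 hx using h
  have hpos : ∀ n : ℕ, (0 : ℝ) < 1 / (n + 1) := fun n => by positivity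
  set y : ℕ → V := fun n => x (1 / (n + 1)) with hy
  have hyE : ∀ n, y n ∈ E := fun n => hxE _ (hpos n)
  have hy0 : ∀ n, 0 < ‖y n‖ := fun n => norm_pos_iff.2 (hx0 _ (hpos n))
  have hyt : Tendsto (fun n => ‖y n‖) atTop (𝓝 0) :=
    squeeze_zero (fun n => norm_nonneg _) (fun n => (hx _ (hpos n)).le)
      tendsto_one_div_add_atTop_nhds_zero_nat
  have : ProperSpace V := FiniteDimensional.proper ℝ V
  obtain ⟨u, hu, φ, hφ, hφu⟩ := (isCompact_sphere (0 : V) 1).tendsto_subseq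
    (x := fun n => ‖y n‖⁻¹ • y n) (fun n => by simp [norm_smul, (hy0 n).ne'])
  refine ⟨u, ?_, fun r => ?_⟩
  · rintro rfl
    simp at hu
  -- As the vectors get short, integral multiples of them have lengths approaching `r`, in a
  -- direction approaching `u`.
  have ht : Tendsto (fun n => (⌊r / ‖y (φ n)‖⌋ * ‖y (φ n)‖ : ℝ)) atTop (𝓝 r) := by
    have h0 : Tendsto (fun n => ‖y (φ n)‖) atTop (𝓝 0) := hyt.comp hφ.tendsto_atTop
    refine tendsto_of_tendsto_of_tendsto_of_le_of_le (g := fun n => r - ‖y (φ n)‖)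
      (h := fun _ => r) ?_ tendsto_const_nhds (fun n => ?_) (fun n => ?_)
    · simpa using h0.const_sub r
    · have := Int.lt_floor_add_one (r / ‖y (φ n)‖)
      rw [div_lt_iff₀ (hy0 _)] at this
      simp only
      linarith
    · have := Int.floor_le (r / ‖y (φ n)‖)
      rwa [le_div_iff₀ (hy0 _)] at this
  refine hE.mem_of_tendsto (ht.smul hφu) (Eventually.of_forall fun n => ?_)
  simp only [Function.comp, smul_smul, mul_assoc, mul_inv_cancel₀ (hy0 (φ n)).ne', mul_one]
  rw [Int.cast_smul_eq_zsmul]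
  exact zsmul_mem (hyE _) _

/-- A discrete spanning subgroup of a plane is the integral span of a basis. -/
theorem exists_basis_of_span_eq_top [FiniteDimensional ℝ V] (hV : finrank ℝ V = 2) {E : AddSubgroup V}
    (hd : ∃ ε > 0, ∀ x ∈ E, ‖x‖ < ε → x = 0) (hs : Submodule.span ℝ (E : Set V) = ⊤) :
    ∃ b : Basis (Fin 2) ℝ V, ∀ v, v ∈ E ↔ ∀ i, ∃ n : ℤ, (n : ℝ) = b.repr v i := by
  obtain ⟨ε, hε, hd⟩ := hd
  have : ProperSpace V := FiniteDimensional.proper ℝ V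
  let L : Submodule ℤ V := AddSubgroup.toIntSubmodule E
  have hL : ∀ x, x ∈ L ↔ x ∈ E := fun x => Iff.rfl
  have : DiscreteTopology L := by
    refine DiscreteTopology.of_forall_le_dist hε fun x y hxy => ?_
    by_contra! hlt
    have := hd (x - y : V) (sub_mem x.2 y.2) (by rwa [← dist_eq_norm])
    exact hxy (Subtype.ext (sub_eq_zero.1 this))
  have : IsZLattice ℝ L := ⟨hs⟩
  have := ZLattice.module_finite ℝ L
  have := ZLattice.module_free ℝ L
  have hr : finrank ℤ L = 2 := by rw [ZLattice.rank ℝ, hV]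
  let b₀ : Basis (Fin 2) ℤ L := finBasisOfFinrankEq ℤ L hr
  refine ⟨b₀.ofZLatticeBasis ℝ L, fun v => ⟨fun hv i => ?_, fun hv => ?_⟩⟩
  · exact ⟨b₀.repr ⟨v, hv⟩ i, (b₀.ofZLatticeBasis_repr_apply ℝ L ⟨v, hv⟩ i).symm⟩
  · choose n hn using hv
    rw [← (b₀.ofZLatticeBasis ℝ L).sum_repr v]
    refine sum_mem fun i _ => ?_
    rw [← hn, Int.cast_smul_eq_zsmul, b₀.ofZLatticeBasis_apply ℝ L]
    exact zsmul_mem (b₀ i).2 _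

theorem exists_basis_apply_zero_eq (hV : finrank ℝ V = 2) {u : V} (hu : u ≠ 0) :
    ∃ b : Basis (Fin 2) ℝ V, b 0 = u := by
  obtain ⟨w, hw⟩ := exists_linearIndependent_pair_of_one_lt_finrank (R := ℝ) (by rw [hV]; norm_num) hu
  exact ⟨basisOfLinearIndependentOfCardEqFinrank hw (by simp [hV]), by simp⟩

/-- Every closed subgroup of a plane is, in a suitable basis, a product of two closed subgroups
of the line. -/
theorem exists_basis_forall_mem_iff [FiniteDimensional ℝ V] (hV : finrank ℝ V = 2) {E : AddSubgroup V}
    (hE : IsClosed (E : Set V)) :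
    ∃ (b : Basis (Fin 2) ℝ V) (c : Fin 2 → ℝ≥0∞),
      ∀ v, v ∈ E ↔ ∀ i, b.repr v i ∈ spacedSubgroup (c i) := by
  have hT : ∀ u : V, ∃ c, ∀ r : ℝ, r • u ∈ E ↔ r ∈ spacedSubgroup c := by
    intro u
    obtain ⟨c, hc⟩ := exists_eq_spacedSubgroup (T := E.comap (LinearMap.toSpanSingleton ℝ V u).toAddMonoidHom)
      (hE.preimage (LinearMap.toSpanSingleton ℝ V u).continuous_of_finiteDimensional)
    exact ⟨c, fun r => by rw [← hc]; simp⟩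
  -- Three cases: `E` contains a line and splits along it; `E` spans and is discrete; or `E` lies in
  -- a line.
  by_cases h1 : ∃ u : V, u ≠ 0 ∧ ∀ r : ℝ, r • u ∈ E
  · obtain ⟨u, hu, hr⟩ := h1
    obtain ⟨b, rfl⟩ := exists_basis_apply_zero_eq hV hu
    obtain ⟨c, hc⟩ := hT (b 1)
    refine ⟨b, ![0, c], fun v => ?_⟩
    have hv := b.sum_repr v
    rw [Fin.sum_univ_two] at hv
    rw [Fin.forall_fin_two]
    simp only [Matrix.cons_val_zero, Matrix.cons_val_one, spacedSubgroup_zero, AddSubgroup.mem_top,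
      true_and, ← hc]
    conv_lhs => rw [← hv]
    exact E.add_mem_cancel_left (hr _)
  by_cases h2 : Submodule.span ℝ (E : Set V) = ⊤
  · obtain ⟨b, hb⟩ := exists_basis_of_span_eq_top hV (by
      by_contra! h
      exact h1 (exists_line_of_short hE fun ε hε => by
        obtain ⟨x, hx, hx1, hx2⟩ := h ε hε
        exact ⟨x, hx, hx2, hx1⟩)) h2
    exact ⟨b, fun _ => 1, fun v => by simp [hb, mem_spacedSubgroup_one]⟩
  · have h3 : finrank ℝ (Submodule.span ℝ (E : Set V)) ≤ 1 := by
      have := Submodule.finrank_lt h2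
      omega
    obtain ⟨w, hw⟩ := finrank_le_one_iff.1 h3
    have hw' : ∃ u : V, u ≠ 0 ∧ ∀ v ∈ E, ∃ r : ℝ, r • u = v := by
      rcases eq_or_ne (w : V) 0 with h0 | h0
      · have : Nontrivial V := Module.nontrivial_of_finrank_pos (R := ℝ) (by rw [hV]; norm_num)
        obtain ⟨u, hu⟩ := exists_ne (0 : V)
        refine ⟨u, hu, fun v hv => ⟨0, ?_⟩⟩
        obtain ⟨r, hr⟩ := hw ⟨v, Submodule.subset_span hv⟩
        have := congrArg Subtype.val hr
        simpa [h0] using this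
      · refine ⟨w, h0, fun v hv => ?_⟩
        obtain ⟨r, hr⟩ := hw ⟨v, Submodule.subset_span hv⟩
        exact ⟨r, congrArg Subtype.val hr⟩
    obtain ⟨u, hu, hr⟩ := hw'
    obtain ⟨b, rfl⟩ := exists_basis_apply_zero_eq hV hu
    obtain ⟨c, hc⟩ := hT (b 0)
    refine ⟨b, ![c, ⊤], fun v => ?_⟩
    have hv := b.sum_repr v
    rw [Fin.sum_univ_two] at hv
    rw [Fin.forall_fin_two]
    simp only [Matrix.cons_val_zero, Matrix.cons_val_one, spacedSubgroup_top, AddSubgroup.mem_bot,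
      ← hc]
    constructor
    · intro hvE
      obtain ⟨r, rfl⟩ := hr v hvE
      simpa using hvE
    · rintro ⟨h, h'⟩
      rw [h', zero_smul, add_zero] at hv
      rwa [← hv]

/-- The closed subgroup of a plane with given spacings along the two vectors of a basis. -/
noncomputable def gridSubgroup (b : Basis (Fin 2) ℝ V) (c : Fin 2 → ℝ≥0∞) : AddSubgroup V where
  carrier := {v | ∀ i, b.repr v i ∈ spacedSubgroup (c i)}
  zero_mem' i := by simp
  add_mem' hv hw i := by simpa using add_mem (hv i) (hw i)
  neg_mem' hv i := by simpa using hv i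

theorem mem_gridSubgroup {b : Basis (Fin 2) ℝ V} {c : Fin 2 → ℝ≥0∞} {v : V} :
    v ∈ gridSubgroup b c ↔ ∀ i, b.repr v i ∈ spacedSubgroup (c i) := Iff.rfl

theorem coe_gridSubgroup (b : Basis (Fin 2) ℝ V) (c : Fin 2 → ℝ≥0∞) :
    (gridSubgroup b c : Set V) =
      b.equivFunL ⁻¹' Set.pi univ fun i => (spacedSubgroup (c i) : Set ℝ) := by
  ext v
  simp [mem_gridSubgroup]

theorem isClosed_gridSubgroup (b : Basis (Fin 2) ℝ V) (c : Fin 2 → ℝ≥0∞) :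
    IsClosed (gridSubgroup b c : Set V) := by
  rw [coe_gridSubgroup]
  exact (isClosed_set_pi fun i _ => isClosed_spacedSubgroup _).preimage b.equivFunL.continuous

theorem fellTendsto_gridSubgroup (b : Basis (Fin 2) ℝ V) (c : Fin 2 → ℝ≥0∞) :
    FellTendsto (fun c => (gridSubgroup b c : Set V)) (𝓝 c) (gridSubgroup b c) := by
  simp only [coe_gridSubgroup]
  refine FellTendsto.preimage (FellTendsto.pi fun i => ?_) b.equivFunL.continuous
    b.equivFunL.toHomeomorph.isOpenMap
  have h := fellTendsto_spacedSubgroup (c i)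
  have ht : Tendsto (fun c : Fin 2 → ℝ≥0∞ => c i) (𝓝 c) (𝓝 (c i)) := (continuous_apply i).tendsto c
  refine ⟨fun x hx O hO => ht.eventually (h.1 x hx O hO), fun x hx => ?_⟩
  obtain ⟨O, hO, h'⟩ := h.2 x hx
  exact ⟨O, hO, ht.eventually h'⟩

theorem exists_eq_gridSubgroup [FiniteDimensional ℝ V] (hV : finrank ℝ V = 2) {E : AddSubgroup V}
    (hE : IsClosed (E : Set V)) : ∃ b c, E = gridSubgroup b c := by
  obtain ⟨b, c, h⟩ := exists_basis_forall_mem_iff hV hE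
  exact ⟨b, c, AddSubgroup.ext h⟩

end Structure

/-! ### Invariant probability measures on quotients -/

section Lattice

open MeasureTheory

variable {G : Type*} [Group G] [TopologicalSpace G]

/-- A lattice is not contained in the kernel of a continuous homomorphism onto `ℝ`. -/
theorem IsGroupLattice.exists_ne_zero {Λ : Subgroup G} (hΛ : IsGroupLattice Λ) {f : G → ℝ}
    (hf : Continuous f) (hmul : ∀ x y, f (x * y) = f x + f y) (hs : Function.Surjective f) :
    ∃ x ∈ Λ, f x ≠ 0 := by
  by_contra! hk
  let : MeasurableSpace (G ⧸ Λ) := borel (G ⧸ Λ)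
  have : BorelSpace (G ⧸ Λ) := ⟨rfl⟩
  obtain ⟨-, μ, hμ, hinv⟩ := hΛ
  have hrel : ∀ a b : G, (QuotientGroup.leftRel Λ) a b → f a = f b := by
    intro a b hab
    rw [QuotientGroup.leftRel_apply] at hab
    have h1 := hmul a (a⁻¹ * b)
    rw [mul_inv_cancel_left, hk _ hab, add_zero] at h1
    exact h1.symm
  let F : G ⧸ Λ → ℝ := Quotient.lift f hrel
  have hF : Continuous F := hf.quotient_lift hrel
  have hFs : ∀ (g : G) (q : G ⧸ Λ), F (g • q) = f g + F q := by
    intro g q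
    induction q using QuotientGroup.induction_on with
    | H x => exact hmul g x
  let ν : Measure ℝ := μ.map F
  have hν : IsProbabilityMeasure ν := Measure.isProbabilityMeasure_map hF.measurable.aemeasurable
  have hνi : ν.IsAddLeftInvariant := by
    refine ⟨fun a => ?_⟩
    obtain ⟨g, rfl⟩ := hs a
    ext s hs
    rw [Measure.map_apply (measurable_const_add _) hs, Measure.map_apply hF.measurable hs,
      Measure.map_apply hF.measurable (measurable_const_add _ hs)]
    rw [← hinv.measure_preimage_smul g (hF.measurable hs)]
    congr 1
    ext q
    simp [hFs]
  -- The pushforward `ν` is translation-invariant on the noncompact group `ℝ`, so its mass would be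
  -- infinite.
  have h1 := measure_univ_of_isAddLeftInvariant ν
  rw [measure_univ] at h1
  exact ENNReal.one_ne_top h1

/-- A discrete subgroup with a fundamental domain of finite measure is a lattice. -/
theorem MeasureTheory.IsFundamentalDomain.isGroupLattice [IsTopologicalGroup G] [PolishSpace G]
    [MeasurableSpace G] [BorelSpace G] {ν : Measure G} [ν.IsMulLeftInvariant]
    [ν.IsMulRightInvariant] [NeZero ν] {Λ : Subgroup G} [DiscreteTopology Λ] {s : Set G}
    (h : IsFundamentalDomain Λ.op s ν) (hs : ν s ≠ ⊤) : IsGroupLattice Λ := by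
  refine ⟨inferInstance, ?_⟩
  have hcl : IsClosed (Λ : Set G) := Subgroup.isClosed_of_discrete
  have : T2Space (G ⧸ Λ) := inferInstance
  have : Countable Λ := countable_of_Lindelof_of_discrete
  have : Countable Λ.op := Λ.equivOp.symm.injective.countable
  have hb : BorelSpace (G ⧸ Λ) := CosetSpace.borelSpace
  have h0 : ν s ≠ 0 := h.measure_ne_zero (NeZero.ne ν)
  -- Right invariance makes `ν` compatible with the action of `Λ.op`; left invariance passes to the
  -- quotient.
  let μ : Measure (G ⧸ Λ) := (ν.restrict s).map (@QuotientGroup.mk G _ Λ)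
  have : HasFundamentalDomain Λ.op G ν := ⟨⟨s, h⟩⟩
  have : QuotientMeasureEqMeasurePreimage ν μ := h.quotientMeasureEqMeasurePreimage_quotientMeasure
  have hi : SMulInvariantMeasure G (G ⧸ Λ) μ :=
    QuotientMeasureEqMeasurePreimage.smulInvariantMeasure_quotient ν
  have hμ : μ univ = ν s := by
    have hm : Measurable (QuotientGroup.mk : G → G ⧸ Λ) := continuous_quotient_mk'.measurable
    rw [Measure.map_apply hm MeasurableSet.univ]
    simp
  rw [← hb.measurable_eq]
  refine ⟨(ν s)⁻¹ • μ, ⟨?_⟩, ⟨fun g A hA => ?_⟩⟩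
  · rw [Measure.smul_apply, hμ, smul_eq_mul, ENNReal.inv_mul_cancel h0 hs]
  · rw [Measure.smul_apply, Measure.smul_apply, measure_preimage_smul]

end Lattice

/-! ### Topology, area form and commutators of the Heisenberg group -/

namespace Heisenberg

/-- The coordinates of the Heisenberg group. -/
noncomputable def homeo : Heisenberg ≃ₜ ℂ × ℝ where
  toFun a := (a.z, a.t)
  invFun q := ⟨q.1, q.2⟩
  left_inv _ := rfl
  right_inv _ := rfl
  continuous_toFun := continuous_induced_dom
  continuous_invFun := continuous_induced_rng.2 continuous_id

theorem homeo_apply (a : Heisenberg) : homeo a = (a.z, a.t) := rfl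

@[fun_prop]
theorem continuous_z : Continuous Heisenberg.z := continuous_fst.comp homeo.continuous

@[fun_prop]
theorem continuous_t : Continuous Heisenberg.t := continuous_snd.comp homeo.continuous

@[fun_prop]
theorem continuous_mk {X : Type*} [TopologicalSpace X] {f : X → ℂ} {g : X → ℝ} (hf : Continuous f)
    (hg : Continuous g) : Continuous fun x => (⟨f x, g x⟩ : Heisenberg) :=
  homeo.symm.continuous.comp (hf.prodMk hg)

noncomputable instance : IsTopologicalGroup Heisenberg where
  continuous_mul := by
    have h1 : Continuous fun q : Heisenberg × Heisenberg => q.1.z := by fun_prop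
    have h2 : Continuous fun q : Heisenberg × Heisenberg => q.2.z := by fun_prop
    exact continuous_mk (by fun_prop) (((continuous_t.comp continuous_fst).add
      (continuous_t.comp continuous_snd)).add (continuous_const.mul
        (Complex.continuous_im.comp ((Complex.continuous_conj.comp h1).mul h2))))
  continuous_inv := continuous_mk (by fun_prop) (by fun_prop)

instance : LocallyCompactSpace Heisenberg := homeo.isClosedEmbedding.locallyCompactSpace

instance : PolishSpace Heisenberg := homeo.isClosedEmbedding.polishSpace

/-- The symplectic form `Im (conj z * w)`. -/
noncomputable def area (z w : ℂ) : ℝ := z.re * w.im - z.im * w.re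

theorem conj_mul_im (z w : ℂ) : ((starRingEnd ℂ) z * w).im = area z w := by
  simp [area]
  ring

theorem area_add_left (z z' w : ℂ) : area (z + z') w = area z w + area z' w := by
  simp [area]; ring

theorem area_add_right (z w w' : ℂ) : area z (w + w') = area z w + area z w' := by
  simp [area]; ring

theorem area_sub_left (z z' w : ℂ) : area (z - z') w = area z w - area z' w := by
  simp [area]; ring

theorem area_sub_right (z w w' : ℂ) : area z (w - w') = area z w - area z w' := by
  simp [area]; ring

theorem area_smul_left (r : ℝ) (z w : ℂ) : area (r * z) w = r * area z w := by
  simp [area]; ring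

theorem area_smul_right (r : ℝ) (z w : ℂ) : area z (r * w) = r * area z w := by
  simp [area]; ring

theorem area_self (z : ℂ) : area z z = 0 := by
  simp [area]; ring

theorem area_swap (z w : ℂ) : area w z = -area z w := by
  simp [area]; ring

@[fun_prop]
theorem continuous_area {X : Type*} [TopologicalSpace X] {f g : X → ℂ} (hf : Continuous f)
    (hg : Continuous g) : Continuous fun x => area (f x) (g x) := by
  unfold area
  fun_prop

theorem abs_area_le (z w : ℂ) : |area z w| ≤ ‖z‖ * ‖w‖ := by
  rw [← conj_mul_im]
  refine (Complex.abs_im_le_norm _).trans ?_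
  simp

/-- Coordinates with respect to two vectors spanning the plane. -/
theorem area_smul_add (a b z : ℂ) :
    (area a b : ℂ) * z = area z b * a + area a z * b := by
  apply Complex.ext <;> simp [area] <;> ring

theorem mul_t' (a b : Heisenberg) : (a * b).t = a.t + b.t + area a.z b.z / 2 := by
  rw [mul_t, conj_mul_im]
  ring

theorem pow_z (a : Heisenberg) (n : ℕ) : (a ^ n).z = n * a.z := by
  induction n with
  | zero => simp
  | succ n ih => rw [pow_succ, mul_z, ih]; push_cast; ring

theorem zpow_z (a : Heisenberg) (n : ℤ) : (a ^ n).z = n * a.z := by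
  cases n with
  | ofNat n => simp [pow_z]
  | negSucc n => rw [zpow_negSucc, inv_z, pow_z]; push_cast; ring

theorem pow_t (a : Heisenberg) (n : ℕ) : (a ^ n).t = n * a.t := by
  induction n with
  | zero => simp
  | succ n ih =>
    have : area ((n : ℂ) * a.z) a.z = 0 := by
      have := area_smul_left n a.z a.z
      rw [area_self, mul_zero] at this
      exact_mod_cast this
    rw [pow_succ, mul_t', pow_z, ih, this]
    push_cast
    ring

theorem zpow_t (a : Heisenberg) (n : ℤ) : (a ^ n).t = n * a.t := by
  cases n with
  | ofNat n => simp [pow_t]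
  | negSucc n => rw [zpow_negSucc, inv_t, pow_t]; push_cast; ring

/-- The central element with coordinate `t`. -/
def central (t : ℝ) : Heisenberg := ⟨0, t⟩

@[simp] theorem central_z (t : ℝ) : (central t).z = 0 := rfl
@[simp] theorem central_t (t : ℝ) : (central t).t = t := rfl

theorem mul_central (a : Heisenberg) (t : ℝ) : a * central t = ⟨a.z, a.t + t⟩ := by
  ext <;> simp

open scoped commutatorElement in
theorem commutator_eq (a b : Heisenberg) : ⁅a, b⁆ = central (area a.z b.z) := by
  rw [commutatorElement_def]
  apply Heisenberg.ext
  · simp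
  · simp only [mul_t', mul_z, inv_z, inv_t, central_t, area]
    simp
    ring

/-- The additive group of the `t` such that the central element `(0, t)` belongs to `D`. -/
noncomputable def centralPart (D : Subgroup Heisenberg) : AddSubgroup ℝ where
  carrier := {t | central t ∈ D}
  zero_mem' := one_mem D
  add_mem' {s t} hs ht := by
    have : central (s + t) = central s * central t := by ext <;> simp
    simpa only [Set.mem_ofPred_eq, this] using mul_mem hs ht
  neg_mem' {s} hs := by
    have : central (-s) = (central s)⁻¹ := by ext <;> simp
    simpa only [Set.mem_ofPred_eq, this] using inv_mem hs

theorem mem_centralPart {D : Subgroup Heisenberg} {t : ℝ} :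
    t ∈ centralPart D ↔ central t ∈ D := Iff.rfl

theorem area_mem_centralPart {D : Subgroup Heisenberg} {a b : Heisenberg} (ha : a ∈ D)
    (hb : b ∈ D) : area a.z b.z ∈ centralPart D := by
  rw [mem_centralPart, ← commutator_eq]
  exact mul_mem (mul_mem (mul_mem ha hb) (inv_mem ha)) (inv_mem hb)

theorem isClosed_centralPart (D : ClosedSubgroup Heisenberg) :
    IsClosed (centralPart D.toSubgroup : Set ℝ) :=
  D.isClosed'.preimage (by unfold central; fun_prop : Continuous central)

/-- The projection of `D` to the plane. -/
noncomputable def planePart (D : Subgroup Heisenberg) : AddSubgroup ℂ where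
  carrier := {z | ∃ a ∈ D, a.z = z}
  zero_mem' := ⟨1, one_mem D, rfl⟩
  add_mem' := by
    rintro _ _ ⟨a, ha, rfl⟩ ⟨b, hb, rfl⟩
    exact ⟨a * b, mul_mem ha hb, rfl⟩
  neg_mem' := by
    rintro _ ⟨a, ha, rfl⟩
    exact ⟨a⁻¹, inv_mem ha, rfl⟩

/-- The plane projection of `D` is the lattice generated by the projections of its elements `a`
and `b`. -/
def IsPlaneBasis (D : Subgroup Heisenberg) (a b : Heisenberg) : Prop :=
  a ∈ D ∧ b ∈ D ∧ area a.z b.z ≠ 0 ∧ ∀ x ∈ D, ∃ m n : ℤ, x.z = m * a.z + n * b.z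

/-! ### Invariance of Lebesgue measure -/

section Measure

open MeasureTheory

noncomputable instance : MeasurableSpace Heisenberg := borel Heisenberg

instance : BorelSpace Heisenberg := ⟨rfl⟩

/-- The Lebesgue measure of the Heisenberg group. -/
noncomputable def haar : Measure Heisenberg := (volume : Measure (ℂ × ℝ)).map homeo.symm

theorem measurePreserving_homeo : MeasurePreserving homeo haar volume := by
  refine ⟨homeo.continuous.measurable, ?_⟩
  rw [haar, Measure.map_map homeo.continuous.measurable homeo.symm.continuous.measurable]
  simp

theorem measurePreserving_homeo_symm : MeasurePreserving homeo.symm volume haar :=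
  ⟨homeo.symm.continuous.measurable, rfl⟩

/-- Left and right translations both have this form in coordinates, so a single Fubini argument
gives both invariances. -/
theorem measurePreserving_shear (w : ℂ) {φ : ℂ → ℝ} (hφ : Continuous φ) :
    MeasurePreserving (fun q : ℂ × ℝ => (w + q.1, φ q.1 + q.2)) volume volume := by
  refine (measurePreserving_add_left volume w).skew_product (g := fun z t => φ z + t) ?_ ?_
  · exact (by fun_prop : Continuous fun q : ℂ × ℝ => φ q.1 + q.2).measurable
  · exact Eventually.of_forall fun z => (measurePreserving_add_left volume (φ z)).map_eq

instance : haar.IsMulLeftInvariant := by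
  refine ⟨fun g => ?_⟩
  have := (measurePreserving_homeo_symm.comp (measurePreserving_shear g.z
    (φ := fun z => g.t + area g.z z / 2) (by fun_prop))).comp measurePreserving_homeo
  convert! this.map_eq using 2
  funext x
  refine Heisenberg.ext rfl ?_
  · rw [mul_t']
    change _ = g.t + area g.z x.z / 2 + x.t
    ring

instance : haar.IsMulRightInvariant := by
  refine ⟨fun g => ?_⟩
  have := (measurePreserving_homeo_symm.comp (measurePreserving_shear g.z
    (φ := fun z => g.t + area z g.z / 2) (by fun_prop))).comp measurePreserving_homeo
  convert! this.map_eq using 2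
  funext x
  refine Heisenberg.ext (add_comm _ _) ?_
  · rw [mul_t']
    change _ = g.t + area x.z g.z / 2 + x.t
    ring

instance : NeZero haar := by
  refine ⟨fun h => ?_⟩
  have := measurePreserving_homeo.measure_preimage MeasurableSet.univ.nullMeasurableSet
  rw [h] at this
  simp [Measure.volume_eq_prod] at this

end Measure

end Heisenberg

section Lattice

open MeasureTheory

/-- The image of a lattice under a continuous surjective homomorphism is a lattice as soon as it is
contained in a discrete subgroup, and then the latter is a lattice. -/
theorem IsGroupLattice.of_map_le {G G' : Type*} [Group G] [TopologicalSpace G] [Group G']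
    [TopologicalSpace G'] [IsTopologicalGroup G'] {Λ : Subgroup G} (hΛ : IsGroupLattice Λ)
    {f : G →* G'} (hf : Continuous f) (hs : Function.Surjective f) {Λ' : Subgroup G'}
    (hd : DiscreteTopology Λ') (hle : Λ ≤ Λ'.comap f) : IsGroupLattice Λ' := by
  refine ⟨hd, ?_⟩
  obtain ⟨-, μ, hμ, hinv⟩ := hΛ
  let : MeasurableSpace (G ⧸ Λ) := borel (G ⧸ Λ)
  have : BorelSpace (G ⧸ Λ) := ⟨rfl⟩
  let : MeasurableSpace (G' ⧸ Λ') := borel (G' ⧸ Λ')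
  have : BorelSpace (G' ⧸ Λ') := ⟨rfl⟩
  have hrel : ∀ a b : G, (QuotientGroup.leftRel Λ) a b →
      (QuotientGroup.mk (f a) : G' ⧸ Λ') = QuotientGroup.mk (f b) := by
    intro a b hab
    rw [QuotientGroup.leftRel_apply] at hab
    rw [QuotientGroup.eq, ← map_inv, ← map_mul]
    exact hle hab
  let F : G ⧸ Λ → G' ⧸ Λ' := Quotient.lift (fun a => QuotientGroup.mk (f a)) hrel
  have hF : Continuous F := (QuotientGroup.continuous_mk.comp hf).quotient_lift hrel
  have hFs : ∀ (g : G) (q : G ⧸ Λ), F (g • q) = f g • F q := by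
    intro g q
    induction q using QuotientGroup.induction_on with
    | H x => exact congrArg _ (map_mul f g x)
  refine ⟨μ.map F, Measure.isProbabilityMeasure_map hF.measurable.aemeasurable, ⟨fun c s hs' => ?_⟩⟩
  obtain ⟨g, rfl⟩ := hs c
  have hc : Measurable fun q : G' ⧸ Λ' => f g • q := (continuous_const_smul (f g)).measurable
  rw [Measure.map_apply hF.measurable hs', Measure.map_apply hF.measurable (hc hs'),
    ← hinv.measure_preimage_smul g (hF.measurable hs')]
  congr 1
  ext q
  simp [hFs]

end Lattice

/-! ### Recognising lattices by projection and central part -/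

namespace Heisenberg

/-- For `w ≠ 0`, the map `x ↦ area w x.z` is a homomorphism onto `ℝ`, so it does not vanish on the
lattice. It is used for `w = 1`, to find `a` with `a.z ≠ 0`, and then for `w = a.z`. -/
theorem exists_area_ne_zero_of_mem_lattices {D : ClosedSubgroup Heisenberg} (hD : D ∈ lattices) :
    ∃ a ∈ D.toSubgroup, ∃ b ∈ D.toSubgroup, area a.z b.z ≠ 0 := by
  have h : ∀ w : ℂ, w ≠ 0 → ∃ x ∈ D.toSubgroup, area w x.z ≠ 0 := by
    intro w hw
    refine IsGroupLattice.exists_ne_zero (f := fun x => area w x.z) hD (by fun_prop)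
      (fun x y => area_add_right _ _ _) fun r => ?_
    have hn : w.re ^ 2 + w.im ^ 2 ≠ 0 := by
      have := Complex.normSq_pos.2 hw
      rw [Complex.normSq_apply] at this
      exact ne_of_gt (by linarith)
    -- The plane coordinate is `r * I * w / ‖w‖ ^ 2`.
    refine ⟨⟨⟨-(r * w.im) / (w.re ^ 2 + w.im ^ 2), r * w.re / (w.re ^ 2 + w.im ^ 2)⟩, 0⟩, ?_⟩
    simp only [area]
    field_simp
    ring
  obtain ⟨a, ha, ha'⟩ := h 1 one_ne_zero
  have ha0 : a.z ≠ 0 := by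
    intro h0
    simp [h0, area] at ha'
  exact ⟨a, ha, h _ ha0⟩

/-- A continuous map from the connected line to a discrete space is constant. -/
theorem centralPart_ne_top_of_discrete {D : Subgroup Heisenberg} [DiscreteTopology D] :
    centralPart D ≠ ⊤ := by
  intro h
  have hm : ∀ t, central t ∈ D := fun t => mem_centralPart.1 (h ▸ AddSubgroup.mem_top t)
  have hc : Continuous fun t : ℝ => (⟨central t, hm t⟩ : D) :=
    Continuous.subtype_mk (by unfold central; fun_prop) _
  have := PreconnectedSpace.constant (inferInstance : PreconnectedSpace ℝ) hc (x := 0) (y := 1)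
  have := congrArg (fun x : D => (x : Heisenberg).t) this
  simp at this

/-- The spacing of the central part is not `⊤`, because it contains the nonzero commutator
coordinate of `a` and `b`. -/
theorem exists_centralPart_eq_zmultiples {D : ClosedSubgroup Heisenberg} {a b : Heisenberg}
    (ha : a ∈ D.toSubgroup) (hb : b ∈ D.toSubgroup) (hab : area a.z b.z ≠ 0)
    (hT : centralPart D.toSubgroup ≠ ⊤) :
    ∃ c > 0, centralPart D.toSubgroup = AddSubgroup.zmultiples c := by
  obtain ⟨c, hc⟩ := exists_eq_spacedSubgroup (isClosed_centralPart D)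
  have h0 : c ≠ 0 := by
    rintro rfl
    exact hT (hc.trans spacedSubgroup_zero)
  have h1 : c ≠ ⊤ := by
    rintro rfl
    have := area_mem_centralPart ha hb
    rw [hc, spacedSubgroup_top, AddSubgroup.mem_bot] at this
    exact hab this
  exact ⟨c.toReal, ENNReal.toReal_pos h0 h1, by rw [hc, spacedSubgroup, if_neg h0]⟩

theorem eq_zero_of_area_eq_zero {a b z : ℂ} (hab : area a b ≠ 0) (h1 : area z b = 0)
    (h2 : area a z = 0) : z = 0 := by
  have := area_smul_add a b z
  rw [h1, h2] at this
  simpa [hab] using this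

theorem eq_area_div_add {a b : ℂ} (hab : area a b ≠ 0) (z : ℂ) :
    z = ((area z b / area a b : ℝ) : ℂ) * a + ((area a z / area a b : ℝ) : ℂ) * b := by
  have h : (area a b : ℂ) ≠ 0 := by exact_mod_cast hab
  have := area_smul_add a b z
  push_cast
  field_simp
  linear_combination this

theorem span_planePart_eq_top {D : Subgroup Heisenberg} {a b : Heisenberg} (ha : a ∈ D) (hb : b ∈ D)
    (hab : area a.z b.z ≠ 0) : Submodule.span ℝ (planePart D : Set ℂ) = ⊤ := by
  rw [eq_top_iff]
  intro z _
  rw [eq_area_div_add hab z]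
  refine add_mem ?_ ?_
  · rw [← Complex.real_smul]
    exact Submodule.smul_mem _ _ (Submodule.subset_span ⟨a, ha, rfl⟩)
  · rw [← Complex.real_smul]
    exact Submodule.smul_mem _ _ (Submodule.subset_span ⟨b, hb, rfl⟩)

theorem area_comb (a b : ℂ) (m n m' n' : ℝ) :
    area (m * a + n * b) (m' * a + n' * b) = (m * n' - n * m') * area a b := by
  simp [area]
  ring

theorem area_basis_ne_zero (β : Module.Basis (Fin 2) ℝ ℂ) : area (β 0) (β 1) ≠ 0 := by
  intro h0
  have h1 := β.sum_repr 1
  have h2 := β.sum_repr Complex.I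
  rw [Fin.sum_univ_two, Complex.real_smul, Complex.real_smul] at h1 h2
  have := area_comb (β 0) (β 1) (β.repr 1 0) (β.repr 1 1) (β.repr Complex.I 0) (β.repr Complex.I 1)
  rw [h1, h2, h0] at this
  simp [area] at this

theorem exists_isPlaneBasis {D : Subgroup Heisenberg}
    (hd : ∃ ε > 0, ∀ z ∈ planePart D, ‖z‖ < ε → z = 0)
    (hs : Submodule.span ℝ (planePart D : Set ℂ) = ⊤) : ∃ a b, IsPlaneBasis D a b := by
  obtain ⟨β, hβ⟩ := exists_basis_of_span_eq_top Complex.finrank_real_complex hd hs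
  have hmem : ∀ i, β i ∈ planePart D := by
    intro i
    rw [hβ]
    intro j
    rw [β.repr_self, Finsupp.single_apply]
    split_ifs
    · exact ⟨1, by simp⟩
    · exact ⟨0, by simp⟩
  obtain ⟨a, ha, ha'⟩ := hmem 0
  obtain ⟨b, hb, hb'⟩ := hmem 1
  refine ⟨a, b, ha, hb, fun h0 => ?_, fun x hx => ?_⟩
  · exact area_basis_ne_zero β (by rwa [← ha', ← hb'])
  · obtain ⟨m, hm⟩ := (hβ x.z).1 ⟨x, hx, rfl⟩ 0
    obtain ⟨n, hn⟩ := (hβ x.z).1 ⟨x, hx, rfl⟩ 1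
    refine ⟨m, n, ?_⟩
    have h1 := β.sum_repr x.z
    rw [Fin.sum_univ_two, Complex.real_smul, Complex.real_smul, ← hm, ← hn] at h1
    rw [ha', hb', ← h1]
    push_cast
    rfl

/-- An element with short projection has commutators with `a` and `b` smaller than the generator
`c`, hence trivial; its projection is then zero. So the projection of `D` is discrete. -/
theorem exists_isPlaneBasis_of_centralPart {D : Subgroup Heisenberg} {a b : Heisenberg} (ha : a ∈ D)
    (hb : b ∈ D) (hab : area a.z b.z ≠ 0) {c : ℝ} (hc : 0 < c)
    (hT : centralPart D = AddSubgroup.zmultiples c) : ∃ a b, IsPlaneBasis D a b := by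
  refine exists_isPlaneBasis ?_ (span_planePart_eq_top ha hb hab)
  have hmul : ∀ t ∈ centralPart D, |t| < c → t = 0 := by
    intro t ht htc
    rw [hT, AddSubgroup.mem_zmultiples_iff] at ht
    obtain ⟨n, rfl⟩ := ht
    rw [zsmul_eq_mul, abs_mul, abs_of_pos hc] at htc
    have : |(n : ℝ)| < 1 := by
      by_contra! h
      nlinarith
    have hn : n = 0 := Int.abs_lt_one_iff.1 (by exact_mod_cast this)
    simp [hn]
  refine ⟨c / (‖a.z‖ + ‖b.z‖ + 1), by positivity, ?_⟩
  rintro _ ⟨x, hx, rfl⟩ hlt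
  rw [lt_div_iff₀ (by positivity)] at hlt
  have h1 := abs_area_le x.z b.z
  have h2 := abs_area_le a.z x.z
  have h3 := norm_nonneg a.z
  have h4 := norm_nonneg b.z
  have h5 := norm_nonneg x.z
  exact eq_zero_of_area_eq_zero hab
    (hmul _ (area_mem_centralPart hx hb) (by nlinarith))
    (hmul _ (area_mem_centralPart ha hx) (by nlinarith))

namespace IsPlaneBasis

variable {D : Subgroup Heisenberg} {a b : Heisenberg}

theorem exists_area_div (h : IsPlaneBasis D a b) {x : Heisenberg} (hx : x ∈ D) :
    ∃ m n : ℤ, x.z = m * a.z + n * b.z ∧ area x.z b.z / area a.z b.z = m ∧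
      area a.z x.z / area a.z b.z = n := by
  obtain ⟨-, -, hab, h⟩ := h
  obtain ⟨m, n, hmn⟩ := h x hx
  refine ⟨m, n, hmn, ?_, ?_⟩
  · rw [div_eq_iff hab, hmn]
    simp [area]
    ring
  · rw [div_eq_iff hab, hmn]
    simp [area]
    ring

theorem exists_area_eq (h : IsPlaneBasis D a b) {x y : Heisenberg} (hx : x ∈ D) (hy : y ∈ D) :
    ∃ k : ℤ, area x.z y.z = k * area a.z b.z := by
  obtain ⟨m, n, hmn⟩ := h.2.2.2 x hx
  obtain ⟨m', n', hmn'⟩ := h.2.2.2 y hy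
  refine ⟨m * n' - n * m', ?_⟩
  have := area_comb a.z b.z m n m' n'
  push_cast at this ⊢
  rw [hmn, hmn', this]

theorem abs_area_eq (h : IsPlaneBasis D a b) {a' b' : Heisenberg} (h' : IsPlaneBasis D a' b') :
    |area a.z b.z| = |area a'.z b'.z| := by
  obtain ⟨k, hk⟩ := h.exists_area_eq h'.1 h'.2.1
  obtain ⟨k', hk'⟩ := h'.exists_area_eq h.1 h.2.1
  have h1 : (k' * k : ℝ) = 1 := by
    have : (k' * k - 1) * area a.z b.z = 0 := by
      linear_combination -hk' - k' * hk
    rcases mul_eq_zero.1 this with h0 | h0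
    · linarith
    · exact (h.2.2.1 h0).elim
  have h2 : k' * k = 1 := by exact_mod_cast h1
  have h3 : |(k' : ℝ)| = 1 := by
    rcases Int.eq_one_or_neg_one_of_mul_eq_one h2 with h | h <;> simp [h]
  rw [hk', abs_mul, h3, one_mul]

end IsPlaneBasis

end Heisenberg

namespace Heisenberg

theorem eq_central {x : Heisenberg} (hx : x.z = 0) : x = central x.t :=
  Heisenberg.ext hx rfl

theorem int_eq_zero_of_abs_mul_lt {n : ℤ} {c : ℝ} (h : |n * c| < |c|) : n = 0 := by
  have hc : 0 < |c| := (abs_nonneg _).trans_lt h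
  rw [abs_mul] at h
  have : |(n : ℝ)| < 1 := by
    by_contra! h1
    nlinarith
  exact Int.abs_lt_one_iff.1 (by exact_mod_cast this)

namespace IsPlaneBasis

variable {D : Subgroup Heisenberg} {a b : Heisenberg}

theorem z_eq_zero (h : IsPlaneBasis D a b) {x : Heisenberg} (hx : x ∈ D)
    (h1 : |area x.z b.z| < |area a.z b.z|) (h2 : |area a.z x.z| < |area a.z b.z|) : x.z = 0 := by
  obtain ⟨m, n, hmn, hm, hn⟩ := h.exists_area_div hx
  rw [div_eq_iff h.2.2.1] at hm hn
  rw [hm] at h1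
  rw [hn] at h2
  rw [hmn, int_eq_zero_of_abs_mul_lt h1, int_eq_zero_of_abs_mul_lt h2]
  simp

theorem discreteTopology (h : IsPlaneBasis D a b) {c : ℝ} (hc : 0 < c)
    (hT : centralPart D = AddSubgroup.zmultiples c) : DiscreteTopology D := by
  apply discreteTopology_of_isOpen_singleton_one
  have ho : IsOpen {x : Heisenberg | |area x.z b.z| < |area a.z b.z| ∧
      |area a.z x.z| < |area a.z b.z| ∧ |x.t| < c} :=
    (isOpen_lt (by fun_prop) (by fun_prop)).and ((isOpen_lt (by fun_prop) (by fun_prop)).and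
      (isOpen_lt (by fun_prop) (by fun_prop)))
  convert ho.preimage continuous_subtype_val using 1
  ext ⟨x, hx⟩
  have hA := abs_pos.2 h.2.2.1
  simp only [Set.mem_singleton_iff, Set.mem_preimage, Set.mem_ofPred_eq, Subgroup.mk_eq_one]
  constructor
  · rintro rfl
    simp [area] at hA ⊢
    exact ⟨hA, hc⟩
  · rintro ⟨h1, h2, h3⟩
    have h0 := h.z_eq_zero hx h1 h2
    have ht : x.t ∈ centralPart D := by
      rw [mem_centralPart, ← eq_central h0]
      exact hx
    rw [hT, AddSubgroup.mem_zmultiples_iff] at ht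
    obtain ⟨n, hn⟩ := ht
    rw [← hn, zsmul_eq_mul] at h3
    have hn0 : n = 0 := int_eq_zero_of_abs_mul_lt (c := c) (by rwa [abs_of_pos hc])
    rw [hn0, zero_smul] at hn
    exact Heisenberg.ext h0 hn.symm

/-- The standard fundamental domain. -/
def cell (a b : Heisenberg) (c : ℝ) : Set Heisenberg :=
  {x | area x.z b.z / area a.z b.z ∈ Ico (0 : ℝ) 1 ∧ area a.z x.z / area a.z b.z ∈ Ico (0 : ℝ) 1 ∧
    x.t ∈ Ico 0 c}

/-- Integer parts of the two plane coordinates determine the powers of `a` and `b`; the remaining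
ambiguity is central and is settled modulo `c`. -/
theorem existsUnique_mul_mem_cell (h : IsPlaneBasis D a b) {c : ℝ} (hc : 0 < c)
    (hT : centralPart D = AddSubgroup.zmultiples c) (x : Heisenberg) :
    ∃! g : D, x * g ∈ cell a b c := by
  have hA := h.2.2.1
  have key : ∀ {r : ℝ} {n n' : ℤ}, r + n ∈ Ico (0 : ℝ) 1 → r + n' ∈ Ico (0 : ℝ) 1 → n = n' := by
    rintro r n n' ⟨h1, h2⟩ ⟨h3, h4⟩
    have h5 : (n : ℝ) < n' + 1 := by linarith
    have h6 : (n' : ℝ) < n + 1 := by linarith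
    have h5 : n < n' + 1 := by exact_mod_cast h5
    have h6 : n' < n + 1 := by exact_mod_cast h6
    omega
  have key' : ∀ r : ℝ, r + ((-⌊r⌋ : ℤ) : ℝ) ∈ Ico (0 : ℝ) 1 := by
    intro r
    have h1 := Int.floor_le r
    have h2 := Int.lt_floor_add_one r
    push_cast
    constructor <;> linarith
  refine existsUnique_of_exists_of_unique ?_ ?_
  · set m : ℤ := -⌊area x.z b.z / area a.z b.z⌋ with hm
    set n : ℤ := -⌊area a.z x.z / area a.z b.z⌋ with hn
    set y : Heisenberg := x * (a ^ m * b ^ n) with hy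
    -- The central correction is computed from `y`, since multiplying by `a ^ m * b ^ n` has already
    -- changed the central coordinate.
    set k : ℤ := -⌊y.t / c⌋ with hk
    have hkD : central (k * c) ∈ D := by
      rw [← mem_centralPart, hT]
      exact ⟨k, by simp⟩
    refine ⟨⟨a ^ m * b ^ n * central (k * c),
      mul_mem (mul_mem (zpow_mem h.1 _) (zpow_mem h.2.1 _)) hkD⟩, ?_⟩
    have hz : y.z = x.z + (m * a.z + n * b.z) := by
      simp [hy, zpow_z]
    rw [← mul_assoc, ← hy, mul_central]
    refine ⟨?_, ?_, ?_⟩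
    · convert key' (area x.z b.z / area a.z b.z) using 1
      rw [← hm]
      simp only [hz]
      field_simp
      simp [area]
      ring
    · convert key' (area a.z x.z / area a.z b.z) using 1
      rw [← hn]
      simp only [hz]
      field_simp
      simp [area]
      ring
    · have := key' (y.t / c)
      rw [← hk] at this
      have he : y.t + k * c = (y.t / c + k) * c := by field_simp
      rw [he]
      exact ⟨mul_nonneg this.1 hc.le, by nlinarith [this.2]⟩
  · rintro ⟨g, hg⟩ ⟨g', hg'⟩ ⟨h1, h2, h3⟩ ⟨h1', h2', h3'⟩
    obtain ⟨m, n, hmn, hm, hn⟩ := h.exists_area_div hg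
    obtain ⟨m', n', hmn', hm', hn'⟩ := h.exists_area_div hg'
    simp only [mul_z, area_add_left, area_add_right, add_div, hm, hm', hn, hn'] at h1 h1' h2 h2'
    have e1 := key h1 h1'
    have e2 := key h2 h2'
    subst e1 e2
    have hz : g.z = g'.z := hmn.trans hmn'.symm
    have ht : central (g'.t - g.t) ∈ D := by
      have : central (g'.t - g.t) = g⁻¹ * g' := by
        apply Heisenberg.ext
        · simp [hz]
        · rw [mul_t', inv_z, inv_t, hz, central_t]
          simp [area]
          ring
      rw [this]
      exact mul_mem (inv_mem hg) hg'
    rw [← mem_centralPart, hT, AddSubgroup.mem_zmultiples_iff] at ht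
    obtain ⟨k, hk⟩ := ht
    have h4 : (x * g').t = (x * g).t + k * c := by
      rw [mul_t', mul_t', hz]
      rw [zsmul_eq_mul] at hk
      linarith
    have hk0 : k = 0 := by
      apply int_eq_zero_of_abs_mul_lt (c := c)
      simp only at h3 h3'
      rw [abs_of_pos hc, abs_lt]
      constructor <;> linarith [h3.1, h3.2, h3'.1, h3'.2]
    rw [hk0, zero_smul] at hk
    exact Subtype.ext (Heisenberg.ext hz (by linarith))

open MeasureTheory in
theorem isGroupLattice (h : IsPlaneBasis D a b) {c : ℝ} (hc : 0 < c)
    (hT : centralPart D = AddSubgroup.zmultiples c) : IsGroupLattice D := by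
  have := h.discreteTopology hc hT
  have hf : IsFundamentalDomain D.op (cell a b c) haar := by
    refine IsFundamentalDomain.mk' ?_ fun x => ?_
    · refine MeasurableSet.nullMeasurableSet (MeasurableSet.inter ?_ (MeasurableSet.inter ?_ ?_))
      · exact (by fun_prop : Continuous fun x : Heisenberg =>
          area x.z b.z / area a.z b.z).measurable measurableSet_Ico
      · exact (by fun_prop : Continuous fun x : Heisenberg =>
          area a.z x.z / area a.z b.z).measurable measurableSet_Ico
      · exact continuous_t.measurable measurableSet_Ico
    · obtain ⟨g, hg, hg'⟩ := h.existsUnique_mul_mem_cell hc hT x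
      refine ⟨D.equivOp g, hg, fun y hy => ?_⟩
      rw [← hg' (D.equivOp.symm y) hy, Equiv.apply_symm_apply]
  refine hf.isGroupLattice (ne_of_lt ?_)
  have hsub : cell a b c ⊆ homeo ⁻¹' (Metric.closedBall 0 (‖a.z‖ + ‖b.z‖) ×ˢ Icc 0 c) := by
    rintro x ⟨h1, h2, h3⟩
    refine ⟨?_, Ico_subset_Icc_self h3⟩
    rw [mem_closedBall_zero_iff, homeo_apply]
    simp only
    rw [eq_area_div_add h.2.2.1 x.z]
    refine (norm_add_le _ _).trans (add_le_add ?_ ?_)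
    · rw [norm_mul, Complex.norm_real, Real.norm_eq_abs, abs_of_nonneg h1.1]
      exact mul_le_of_le_one_left (norm_nonneg _) h1.2.le
    · rw [norm_mul, Complex.norm_real, Real.norm_eq_abs, abs_of_nonneg h2.1]
      exact mul_le_of_le_one_left (norm_nonneg _) h2.2.le
  have hK : IsCompact (Metric.closedBall (0 : ℂ) (‖a.z‖ + ‖b.z‖) ×ˢ Icc 0 c) :=
    (isCompact_closedBall _ _).prod isCompact_Icc
  refine (measure_mono hsub).trans_lt ?_
  rw [measurePreserving_homeo.measure_preimage hK.measurableSet.nullMeasurableSet]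
  exact hK.measure_lt_top

end IsPlaneBasis

/-- The measure-theoretic definition is eliminated here: what remains is noncommutativity together
with not containing the whole centre. -/
theorem mem_lattices_iff {D : ClosedSubgroup Heisenberg} :
    D ∈ lattices ↔ (∃ a ∈ D.toSubgroup, ∃ b ∈ D.toSubgroup, area a.z b.z ≠ 0) ∧
      centralPart D.toSubgroup ≠ ⊤ := by
  constructor
  · intro hD
    have : DiscreteTopology D.toSubgroup := hD.1
    exact ⟨exists_area_ne_zero_of_mem_lattices hD, centralPart_ne_top_of_discrete⟩
  · rintro ⟨⟨a, ha, b, hb, hab⟩, hT⟩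
    obtain ⟨c, hc, hT⟩ := exists_centralPart_eq_zmultiples ha hb hab hT
    obtain ⟨a', b', h⟩ := exists_isPlaneBasis_of_centralPart ha hb hab hc hT
    exact h.isGroupLattice hc hT

/-- The subgroup of the elements with plane coordinate in `E` and central coordinate in `cℤ`. -/
noncomputable def cover (E : AddSubgroup ℂ) (c : ℝ≥0∞)
    (h : ∀ z ∈ E, ∀ w ∈ E, area z w / 2 ∈ spacedSubgroup c) : Subgroup Heisenberg where
  carrier := {x | x.z ∈ E ∧ x.t ∈ spacedSubgroup c}
  one_mem' := ⟨zero_mem E, zero_mem _⟩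
  mul_mem' := by
    rintro x y ⟨hx, hx'⟩ ⟨hy, hy'⟩
    exact ⟨add_mem hx hy, by rw [mul_t']; exact add_mem (add_mem hx' hy') (h _ hx _ hy)⟩
  inv_mem' := by
    rintro x ⟨hx, hx'⟩
    exact ⟨neg_mem hx, neg_mem hx'⟩

theorem mem_cover {E : AddSubgroup ℂ} {c : ℝ≥0∞}
    {h : ∀ z ∈ E, ∀ w ∈ E, area z w / 2 ∈ spacedSubgroup c} {x : Heisenberg} :
    x ∈ cover E c h ↔ x.z ∈ E ∧ x.t ∈ spacedSubgroup c := Iff.rfl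

theorem centralPart_cover {E : AddSubgroup ℂ} {c : ℝ≥0∞}
    {h : ∀ z ∈ E, ∀ w ∈ E, area z w / 2 ∈ spacedSubgroup c} :
    centralPart (cover E c h) = spacedSubgroup c := by
  ext t
  simp [mem_centralPart, mem_cover]

theorem mem_comap_p {L : Subgroup (Multiplicative ℂ)} {x : Heisenberg} :
    x ∈ L.comap p ↔ Multiplicative.ofAdd x.z ∈ L := Iff.rfl

theorem continuous_p : Continuous p := continuous_z

theorem surjective_p : Function.Surjective p := fun z => ⟨⟨z.toAdd, 0⟩, rfl⟩

/-- In the converse direction, the invariant measure for `L` in the plane is obtained by pushing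
forward that of a lattice in the Heisenberg group with the same projection. -/
theorem mem_latticesInfty_iff {D : ClosedSubgroup Heisenberg} :
    D ∈ latticesInfty ↔ centralPart D.toSubgroup = ⊤ ∧ ∃ a b, IsPlaneBasis D.toSubgroup a b := by
  constructor
  · rintro ⟨L, hL, hD⟩
    rw [hD]
    have hmem : ∀ z, z ∈ planePart (L.comap p) ↔ Multiplicative.ofAdd z ∈ L :=
      fun z => ⟨fun ⟨x, hx, hxz⟩ => hxz ▸ hx, fun hz => ⟨⟨z, 0⟩, hz, rfl⟩⟩
    refine ⟨?_, exists_isPlaneBasis ?_ ?_⟩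
    · ext t
      simp only [mem_centralPart, mem_comap_p, AddSubgroup.mem_top, iff_true]
      exact one_mem L
    · have hd : DiscreteTopology L := hL.1
      have h1 : IsOpen ({1} : Set L) := isOpen_discrete _
      obtain ⟨O, hO, hO1⟩ := isOpen_induced_iff.1 h1
      have h1O : (1 : Multiplicative ℂ) ∈ O := by
        have : (1 : L) ∈ Subtype.val ⁻¹' O := by rw [hO1]; rfl
        exact this
      have hO' : IsOpen (Multiplicative.ofAdd ⁻¹' O) := hO.preimage continuous_ofAdd
      obtain ⟨ε, hε, hball⟩ := Metric.isOpen_iff.1 hO' 0 h1O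
      refine ⟨ε, hε, fun z hz hzε => ?_⟩
      have hzO : Multiplicative.ofAdd z ∈ O := hball (mem_ball_zero_iff.2 hzε : z ∈ Metric.ball 0 ε)
      have : (⟨_, (hmem z).1 hz⟩ : L) ∈ Subtype.val ⁻¹' O := hzO
      rw [hO1, mem_singleton_iff, Subgroup.mk_eq_one] at this
      exact this
    · by_contra hs
      -- If `L` did not span, a nonzero linear functional would vanish on it, which a lattice does
      -- not allow.
      obtain ⟨f, hf0, hf⟩ := Submodule.exists_le_ker_of_lt_top _ (lt_top_iff_ne_top.2 hs)
      obtain ⟨x, hx, hx0⟩ := hL.exists_ne_zero (f := fun z => f z.toAdd)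
        (f.continuous_of_finiteDimensional.comp continuous_toAdd) (fun x y => map_add f _ _)
        (fun r => by
          obtain ⟨z, hz⟩ := LinearMap.surjective hf0 r
          exact ⟨Multiplicative.ofAdd z, hz⟩)
      exact hx0 (hf (Submodule.subset_span ((hmem x.toAdd).2 hx)))
  · rintro ⟨hT, a, b, h⟩
    let L : Subgroup (Multiplicative ℂ) := AddSubgroup.toSubgroup (planePart D.toSubgroup)
    have hL : D.toSubgroup = L.comap p := by
      ext x
      constructor
      · exact fun hx => ⟨x, hx, rfl⟩
      · rintro ⟨y, hy, hyx⟩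
        have hyz : y.z = x.z := hyx
        have hc : central (x.t - y.t) ∈ D.toSubgroup := by
          rw [← mem_centralPart, hT]
          trivial
        have : x = y * central (x.t - y.t) := by
          rw [mul_central]
          exact Heisenberg.ext hyz.symm (by simp)
        rw [this]
        exact mul_mem hy hc
    have hA := h.2.2.1
    have hA2 : 0 < |area a.z b.z| / 2 := by positivity
    have hdisc : DiscreteTopology L := by
      apply discreteTopology_of_isOpen_singleton_one
      have ho : IsOpen {z : Multiplicative ℂ | |area z.toAdd b.z| < |area a.z b.z| ∧
          |area a.z z.toAdd| < |area a.z b.z|} := by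
        have : IsOpen {z : ℂ | |area z b.z| < |area a.z b.z| ∧ |area a.z z| < |area a.z b.z|} :=
          (isOpen_lt (by fun_prop) (by fun_prop)).and (isOpen_lt (by fun_prop) (by fun_prop))
        exact this.preimage continuous_toAdd
      convert ho.preimage continuous_subtype_val using 1
      ext ⟨x, hx⟩
      simp only [Set.mem_singleton_iff, Set.mem_preimage, Set.mem_ofPred_eq, Subgroup.mk_eq_one]
      constructor
      · rintro rfl
        have := abs_pos.2 hA
        simpa [area] using this
      · rintro ⟨h1, h2⟩
        obtain ⟨y, hy, hyx⟩ := hx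
        have hyx : y.z = x.toAdd := hyx
        rw [← hyx] at h1 h2
        have := h.z_eq_zero hy h1 h2
        rw [hyx] at this
        exact this
    -- The group law involves half the area, so the auxiliary lattice takes half the area of the
    -- basis as its central spacing.
    have hE : ∀ z ∈ planePart D.toSubgroup, ∀ w ∈ planePart D.toSubgroup,
        area z w / 2 ∈ spacedSubgroup (ENNReal.ofReal (|area a.z b.z| / 2)) := by
      rintro _ ⟨x, hx, rfl⟩ _ ⟨y, hy, rfl⟩
      obtain ⟨k, hk⟩ := h.exists_area_eq hx hy
      rw [mem_spacedSubgroup_ofReal hA2, hk]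
      rcases abs_choice (area a.z b.z) with h | h
      · exact ⟨k, by rw [h]; ring⟩
      · exact ⟨-k, by rw [h]; push_cast; ring⟩
    have hb : IsPlaneBasis (cover _ _ hE) ⟨a.z, 0⟩ ⟨b.z, 0⟩ := by
      refine ⟨⟨⟨a, h.1, rfl⟩, zero_mem _⟩, ⟨⟨b, h.2.1, rfl⟩, zero_mem _⟩, hA, ?_⟩
      rintro x ⟨⟨y, hy, hyx⟩, -⟩
      rw [← hyx]
      exact h.2.2.2 y hy
    have hlat := hb.isGroupLattice hA2 (by
      rw [centralPart_cover, spacedSubgroup, if_neg (by simpa using hA),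
        ENNReal.toReal_ofReal hA2.le])
    exact ⟨L, hlat.of_map_le continuous_p surjective_p hdisc fun x hx => hx.1, hL⟩

theorem mem_latticesBangBang_iff {D : ClosedSubgroup Heisenberg} :
    D ∈ latticesBangBang ↔ ∃ a b, IsPlaneBasis D.toSubgroup a b := by
  constructor
  · rintro (hD | hD)
    · obtain ⟨⟨a, ha, b, hb, hab⟩, hT⟩ := mem_lattices_iff.1 hD
      obtain ⟨c, hc, hT⟩ := exists_centralPart_eq_zmultiples ha hb hab hT
      exact exists_isPlaneBasis_of_centralPart ha hb hab hc hT
    · exact (mem_latticesInfty_iff.1 hD).2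
  · rintro ⟨a, b, h⟩
    by_cases hT : centralPart D.toSubgroup = ⊤
    · exact Or.inr (mem_latticesInfty_iff.2 ⟨hT, a, b, h⟩)
    · exact Or.inl (mem_lattices_iff.2 ⟨⟨a, h.1, b, h.2.1, h.2.2.1⟩, hT⟩)

/-- Every lattice has a plane basis `a, b`, and a generator `c` of its centre, such that
`area a b` is a positive integral multiple of `c`. -/
theorem exists_isPlaneBasis_of_mem_lattices {D : ClosedSubgroup Heisenberg} (hD : D ∈ lattices) :
    ∃ a b c, ∃ k : ℤ, IsPlaneBasis D.toSubgroup a b ∧ 0 < c ∧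
      centralPart D.toSubgroup = AddSubgroup.zmultiples c ∧ area a.z b.z = k * c := by
  obtain ⟨⟨a, ha, b, hb, hab⟩, hT⟩ := mem_lattices_iff.1 hD
  obtain ⟨c, hc, hT⟩ := exists_centralPart_eq_zmultiples ha hb hab hT
  obtain ⟨a', b', h⟩ := exists_isPlaneBasis_of_centralPart ha hb hab hc hT
  have := area_mem_centralPart h.1 h.2.1
  rw [hT, AddSubgroup.mem_zmultiples_iff] at this
  obtain ⟨k, hk⟩ := this
  exact ⟨a', b', c, k, h, hc, hT, by rw [← hk, zsmul_eq_mul]⟩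

end Heisenberg

/-! ### Stability of plane bases and openness -/

/-- In a group where the elements of size at most `r` have size less than `r / 2`, these elements
have size zero. -/
theorem eq_zero_of_forall_le_imp_lt_half {E : Type*} [AddGroup E] {T : AddSubgroup E} {N : E → ℝ}
    (hN : ∀ z, N (z + z) = 2 * N z) (hN0 : ∀ z, 0 ≤ N z) {r : ℝ}
    (h : ∀ z ∈ T, N z ≤ r → N z < r / 2) {z : E} (hz : z ∈ T) (hzr : N z ≤ r) : N z = 0 := by
  -- The double `z + z` again has size at most `r`, so a bound for all such elements can be halved
  -- repeatedly.
  have key : ∀ n : ℕ, ∀ z ∈ T, N z ≤ r → N z ≤ r * (1 / 2) ^ n := by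
    intro n
    induction n with
    | zero => intro z _ hzr; simpa using hzr
    | succ n ih =>
      intro z hz hzr
      have h1 := h z hz hzr
      have h2 := ih (z + z) (add_mem hz hz) (by rw [hN]; linarith)
      rw [hN] at h2
      rw [pow_succ]
      linarith
  have ht : Tendsto (fun n : ℕ => r * (1 / 2) ^ n) atTop (𝓝 (r * 0)) :=
    (tendsto_pow_atTop_nhds_zero_of_lt_one (by norm_num) (by norm_num)).const_mul r
  rw [mul_zero] at ht
  exact le_antisymm (ge_of_tendsto' ht fun n => key n z hz hzr) (hN0 z)

namespace Heisenberg

theorem abs_sub_round_mul_le {A : ℝ} (hA : A ≠ 0) (x : ℝ) : |x - round (x / A) * A| ≤ |A| / 2 := by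
  have h := abs_sub_round (x / A)
  have : x - round (x / A) * A = (x / A - round (x / A)) * A := by
    field_simp
  rw [this, abs_mul]
  nlinarith [abs_nonneg A]

theorem isCompact_of_bounded {S : Set Heisenberg} (hS : IsClosed S) {M R : ℝ}
    (h : ∀ x ∈ S, ‖x.z‖ ≤ M ∧ |x.t| ≤ R) : IsCompact S := by
  have hK : IsCompact (homeo ⁻¹' (Metric.closedBall 0 M ×ˢ Metric.closedBall 0 R)) :=
    homeo.isCompact_preimage.2 ((isCompact_closedBall _ _).prod (isCompact_closedBall _ _))
  refine hK.of_isClosed_subset hS fun x hx => ⟨?_, ?_⟩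
  · simpa [homeo_apply] using (h x hx).1
  · simpa [homeo_apply] using (h x hx).2

/-- If `D` contains elements close to `a` and `b`, and avoids a suitable compact set, these form a
plane basis of `D`. -/
theorem isPlaneBasis_of_close {D : Subgroup Heisenberg} {a b a' b' : Heisenberg}
    (ha' : a' ∈ D) (hb' : b' ∈ D) {A M : ℝ} (hA : 0 < A) (hM : ‖a'.z‖ + ‖b'.z‖ ≤ 2 * M)
    (ha : M * ‖a'.z - a.z‖ < A / 32) (hb : M * ‖b'.z - b.z‖ < A / 32)
    (h1 : 15 / 16 * A < |area a'.z b'.z|) (h2 : |area a'.z b'.z| < 17 / 16 * A)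
    (hD : ∀ x ∈ D, ‖x.z‖ ≤ M → |x.t| ≤ 2 * A → |area x.z b.z| ≤ 3 / 4 * A →
      |area a.z x.z| ≤ 3 / 4 * A → |area x.z b.z| < A / 8 ∧ |area a.z x.z| < A / 8) :
    IsPlaneBasis D a' b' := by
  have hA' : area a'.z b'.z ≠ 0 := abs_pos.1 (by linarith)
  have hsmall : ∀ z ∈ planePart D, max |area z b'.z| |area a'.z z| ≤ |area a'.z b'.z| / 2 →
      max |area z b'.z| |area a'.z z| < |area a'.z b'.z| / 2 / 2 := by
    rintro _ ⟨x, hx, rfl⟩ hle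
    obtain ⟨hle1, hle2⟩ := max_le_iff.1 hle
    -- A power of the commutator of `a'` and `b'` brings the central coordinate into the bounded
    -- range of `hD` without changing the projection.
    set y := x * central (-round (x.t / area a'.z b'.z) * area a'.z b'.z) with hy
    have hyD : y ∈ D := by
      refine mul_mem hx ?_
      rw [← mem_centralPart]
      have := zsmul_mem (area_mem_centralPart ha' hb') (-round (x.t / area a'.z b'.z))
      simpa using this
    have hyz : y.z = x.z := by simp [hy]
    have hyt : |y.t| ≤ 2 * A := by
      have := abs_sub_round_mul_le hA' x.t
      have h3 : y.t = x.t - round (x.t / area a'.z b'.z) * area a'.z b'.z := by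
        rw [hy, mul_central]
        simp only
        ring
      rw [h3]
      linarith
    have hn : ‖x.z‖ ≤ M := by
      rw [eq_area_div_add hA' x.z]
      have hh : ∀ r : ℝ, |r| ≤ |area a'.z b'.z| / 2 → ∀ w : ℂ,
          ‖((r / area a'.z b'.z : ℝ) : ℂ) * w‖ ≤ ‖w‖ / 2 := by
        intro r hr w
        rw [norm_mul, Complex.norm_real, Real.norm_eq_abs, abs_div]
        have : |r| / |area a'.z b'.z| ≤ 1 / 2 := by
          rw [div_le_iff₀ (abs_pos.2 hA')]
          linarith
        nlinarith [norm_nonneg w]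
      linarith [norm_add_le (((area x.z b'.z / area a'.z b'.z : ℝ) : ℂ) * a'.z)
        (((area a'.z x.z / area a'.z b'.z : ℝ) : ℂ) * b'.z), hh _ hle1 a'.z, hh _ hle2 b'.z]
    have hd1 : |area x.z b'.z - area x.z b.z| < A / 32 := by
      rw [← area_sub_right]
      exact (abs_area_le _ _).trans_lt
        ((mul_le_mul_of_nonneg_right hn (norm_nonneg _)).trans_lt hb)
    have hd2 : |area a'.z x.z - area a.z x.z| < A / 32 := by
      rw [← area_sub_left]
      refine (abs_area_le _ _).trans_lt ?_
      rw [mul_comm]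
      exact (mul_le_mul_of_nonneg_right hn (norm_nonneg _)).trans_lt ha
    have hq := hD y hyD
    rw [hyz] at hq
    rw [abs_lt] at hd1 hd2
    rw [abs_le] at hle1 hle2
    obtain ⟨hq1, hq2⟩ := hq hn hyt (by rw [abs_le]; constructor <;> linarith [hd1.1, hd1.2, hle1.1, hle1.2])
      (by rw [abs_le]; constructor <;> linarith [hd2.1, hd2.2, hle2.1, hle2.2])
    rw [abs_lt] at hq1 hq2
    refine max_lt ?_ ?_
    · rw [abs_lt]
      constructor <;> linarith [hd1.1, hd1.2, hq1.1, hq1.2]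
    · rw [abs_lt]
      constructor <;> linarith [hd2.1, hd2.2, hq2.1, hq2.2]
  refine ⟨ha', hb', hA', fun x hx => ?_⟩
  -- Rounding leaves a remainder whose coordinates are at most half the area, which is the threshold
  -- in `hsmall`; the halving lemma makes it vanish.
  set m := round (area x.z b'.z / area a'.z b'.z) with hm
  set n := round (area a'.z x.z / area a'.z b'.z) with hn
  have hz : x.z - (m * a'.z + n * b'.z) ∈ planePart D := by
    refine ⟨x * (a' ^ m * b' ^ n)⁻¹, mul_mem hx (inv_mem (mul_mem (zpow_mem ha' _) (zpow_mem hb' _))), ?_⟩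
    simp only [mul_z, inv_z, zpow_z]
    ring
  have e1 : area (x.z - (m * a'.z + n * b'.z)) b'.z = area x.z b'.z - m * area a'.z b'.z := by
    simp [area]
    ring
  have e2 : area a'.z (x.z - (m * a'.z + n * b'.z)) = area a'.z x.z - n * area a'.z b'.z := by
    simp [area]
    ring
  have h0 := eq_zero_of_forall_le_imp_lt_half (N := fun z => max |area z b'.z| |area a'.z z|) (T := planePart D)
    (fun z => by
      have e1 : area (z + z) b'.z = 2 * area z b'.z := by rw [area_add_left]; ring
      have e2 : area a'.z (z + z) = 2 * area a'.z z := by rw [area_add_right]; ring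
      simp only [e1, e2, abs_mul, abs_two]
      rw [mul_max_of_nonneg _ _ (by norm_num)])
    (fun z => le_max_of_le_left (abs_nonneg _)) hsmall hz (by
      rw [e1, e2]
      exact max_le (abs_sub_round_mul_le hA' _) (abs_sub_round_mul_le hA' _))
  have h3 : |area (x.z - (m * a'.z + n * b'.z)) b'.z| ≤ 0 := h0 ▸ le_max_left _ _
  have h4 : |area a'.z (x.z - (m * a'.z + n * b'.z))| ≤ 0 := h0 ▸ le_max_right _ _
  exact ⟨m, n, sub_eq_zero.1 (eq_zero_of_area_eq_zero hA' (abs_nonpos_iff.1 h3) (abs_nonpos_iff.1 h4))⟩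

/-- If `D` is close to a subgroup `C` with plane basis `a, b`, then it has a plane basis close to
`a, b`. -/
theorem IsPlaneBasis.eventually {C : ClosedSubgroup Heisenberg} {a b : Heisenberg}
    (h : IsPlaneBasis C.toSubgroup a b) {η : ℝ} (hη : 0 < η) :
    ∀ᶠ D : ClosedSubgroup Heisenberg in 𝓝 C, ∃ a' b', IsPlaneBasis D.toSubgroup a' b' ∧
      ‖a'.z - a.z‖ < η ∧ ‖b'.z - b.z‖ < η ∧ |area a'.z b'.z - area a.z b.z| < η := by
  set A := |area a.z b.z| with hAdef
  have hA : 0 < A := abs_pos.2 h.2.2.1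
  set M := ‖a.z‖ + ‖b.z‖ + 1 with hMdef
  have ha0 := norm_nonneg a.z
  have hb0 := norm_nonneg b.z
  have hM : 0 < M := by positivity
  -- In `K` both area coordinates have absolute value at most `3 / 4 * A` and one of them is at
  -- least `A / 8`. On `C` these coordinates are integral multiples of `A` up to sign, so `C` avoids
  -- `K`.
  set K : Set Heisenberg := {x | ‖x.z‖ ≤ M ∧ |x.t| ≤ 2 * A ∧ |area x.z b.z| ≤ 3 / 4 * A ∧
    |area a.z x.z| ≤ 3 / 4 * A ∧ A / 8 ≤ max |area x.z b.z| |area a.z x.z|} with hKdef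
  have hK : IsCompact K := by
    refine isCompact_of_bounded (M := M) (R := 2 * A) ?_ fun x hx => ⟨hx.1, hx.2.1⟩
    exact (isClosed_le (by fun_prop) (by fun_prop)).and ((isClosed_le (by fun_prop) (by fun_prop)).and
      ((isClosed_le (by fun_prop) (by fun_prop)).and ((isClosed_le (by fun_prop) (by fun_prop)).and
      (isClosed_le (by fun_prop) (by fun_prop)))))
  have hCK : Disjoint (C : Set Heisenberg) K := by
    refine Set.disjoint_left.2 fun x hx hxK => ?_
    obtain ⟨-, -, h1, h2, h3⟩ := hxK
    have h0 := h.z_eq_zero hx (by linarith) (by linarith)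
    rw [h0] at h3
    simp [area] at h3
    linarith
  obtain ⟨δ, hδ, hδ1, hδη, hδA, hδη'⟩ : ∃ δ > 0, δ ≤ 1 ∧ δ ≤ η ∧ M * δ ≤ A / 32 ∧ M * δ ≤ η / 2 := by
    refine ⟨min (min 1 η) (min (A / 32 / M) (η / 2 / M)), by positivity, ?_, ?_, ?_, ?_⟩
    · exact (min_le_left _ _).trans (min_le_left _ _)
    · exact (min_le_left _ _).trans (min_le_right _ _)
    · rw [← le_div_iff₀' hM]
      exact (min_le_right _ _).trans (min_le_left _ _)
    · rw [← le_div_iff₀' hM]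
      exact (min_le_right _ _).trans (min_le_right _ _)
  have hO : ∀ d : Heisenberg, {x : Heisenberg | ‖x.z - d.z‖ < δ} ∈ 𝓝 d := fun d =>
    (isOpen_lt (by fun_prop) (by fun_prop)).mem_nhds (by simpa using hδ)
  filter_upwards [ClosedSubgroup.eventually_inter_nonempty h.1 (hO a),
    ClosedSubgroup.eventually_inter_nonempty h.2.1 (hO b), ClosedSubgroup.eventually_disjoint hK hCK]
  rintro D ⟨a', ha', haδ⟩ ⟨b', hb', hbδ⟩ hDK
  simp only [Set.mem_ofPred_eq] at haδ hbδ
  have hna : ‖a'.z‖ ≤ ‖a.z‖ + 1 := by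
    have := norm_add_le (a'.z - a.z) a.z
    rw [sub_add_cancel] at this
    linarith
  have hnb : ‖b'.z‖ ≤ ‖b.z‖ + 1 := by
    have := norm_add_le (b'.z - b.z) b.z
    rw [sub_add_cancel] at this
    linarith
  have hMa : M * ‖a'.z - a.z‖ < M * δ := by gcongr
  have hMb : M * ‖b'.z - b.z‖ < M * δ := by gcongr
  have hd : |area a'.z b'.z - area a.z b.z| < 2 * (M * δ) := by
    have e : area a'.z b'.z - area a.z b.z = area (a'.z - a.z) b'.z + area a.z (b'.z - b.z) := by
      rw [area_sub_left, area_sub_right]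
      ring
    rw [e]
    have i1 := abs_add_le (area (a'.z - a.z) b'.z) (area a.z (b'.z - b.z))
    have i2 := abs_area_le (a'.z - a.z) b'.z
    have i3 := abs_area_le a.z (b'.z - b.z)
    have i4 : ‖a'.z - a.z‖ * ‖b'.z‖ ≤ M * ‖a'.z - a.z‖ := by
      rw [mul_comm]
      exact mul_le_mul_of_nonneg_right (by linarith) (norm_nonneg _)
    have i5 : ‖a.z‖ * ‖b'.z - b.z‖ ≤ M * ‖b'.z - b.z‖ :=
      mul_le_mul_of_nonneg_right (by linarith) (norm_nonneg _)
    linarith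
  have hd' : |(|area a'.z b'.z| - A)| < A / 16 :=
    (abs_abs_sub_abs_le_abs_sub _ _).trans_lt (by linarith)
  rw [abs_lt] at hd'
  refine ⟨a', b', isPlaneBasis_of_close (a := a) (b := b) ha' hb' hA (M := M) (by linarith) (by linarith)
    (by linarith) (by linarith) (by linarith) ?_, by linarith, by linarith, by linarith⟩
  intro x hx h1 h2 h3 h4
  by_contra hcon
  rw [not_and_or, not_lt, not_lt, ← le_max_iff] at hcon
  exact Set.disjoint_left.1 hDK hx ⟨h1, h2, h3, h4, hcon⟩

theorem isOpen_latticesBangBang : IsOpen latticesBangBang := by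
  refine isOpen_iff_mem_nhds.2 fun C hC => ?_
  obtain ⟨a, b, h⟩ := mem_latticesBangBang_iff.1 hC
  filter_upwards [h.eventually one_pos] with D ⟨a', b', h', _⟩
  exact mem_latticesBangBang_iff.2 ⟨a', b', h'⟩

/-- Missing one particular central element is an open condition, and it rules out the subgroups
containing the whole centre. -/
theorem isOpen_lattices : IsOpen lattices := by
  refine isOpen_iff_mem_nhds.2 fun C hC => ?_
  obtain ⟨a, b, h⟩ := mem_latticesBangBang_iff.1 (Or.inl hC)
  obtain ⟨t, ht⟩ : ∃ t, t ∉ centralPart C.toSubgroup := by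
    by_contra! hcon
    exact (mem_lattices_iff.1 hC).2 (eq_top_iff.2 fun t _ => hcon t)
  have hdisj : Disjoint (C : Set Heisenberg) {central t} := Set.disjoint_singleton_right.2 ht
  filter_upwards [h.eventually one_pos, ClosedSubgroup.eventually_disjoint isCompact_singleton hdisj]
    with D ⟨a', b', h', _⟩ hD
  refine mem_lattices_iff.2 ⟨⟨a', h'.1, b', h'.2.1, h'.2.2.1⟩, fun hT => ?_⟩
  exact Set.disjoint_singleton_right.1 hD (mem_centralPart.1 (hT ▸ AddSubgroup.mem_top t))

/-- Central elements of `C` are approached by central elements of the subgroups close to `C`. -/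
theorem IsPlaneBasis.eventually_centralPart {C : ClosedSubgroup Heisenberg} {a b : Heisenberg}
    (h : IsPlaneBasis C.toSubgroup a b) {t : ℝ} (ht : t ∈ centralPart C.toSubgroup) {ε : ℝ}
    (hε : 0 < ε) :
    ∀ᶠ D : ClosedSubgroup Heisenberg in 𝓝 C, ∃ t' ∈ centralPart D.toSubgroup, |t' - t| < ε := by
  have hA : 0 < |area a.z b.z| := abs_pos.2 h.2.2.1
  set M := ‖a.z‖ + ‖b.z‖ + 1 with hMdef
  have ha0 := norm_nonneg a.z
  have hb0 := norm_nonneg b.z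
  have hM : 0 < M := by positivity
  -- The bound on `x.z` is so small that an element of `D` in this set has integral plane
  -- coordinates of absolute value below one, and is therefore exactly central.
  have hO : {x : Heisenberg | |x.t - t| < ε ∧ ‖x.z‖ * M < |area a.z b.z| / 2} ∈ 𝓝 (central t) := by
    refine ((isOpen_lt (by fun_prop) (by fun_prop)).and
      (isOpen_lt (by fun_prop) (by fun_prop))).mem_nhds ⟨?_, ?_⟩
    · simpa using hε
    · simpa using h.2.2.1
  filter_upwards [h.eventually (lt_min one_pos (half_pos hA)),
    ClosedSubgroup.eventually_inter_nonempty (mem_centralPart.1 ht) hO]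
  rintro D ⟨a', b', h', ha', hb', hab'⟩ ⟨d, hd, hdt, hdz⟩
  rw [lt_min_iff] at ha' hb' hab'
  have hna : ‖a'.z‖ ≤ M := by
    have := norm_add_le (a'.z - a.z) a.z
    rw [sub_add_cancel] at this
    linarith
  have hnb : ‖b'.z‖ ≤ M := by
    have := norm_add_le (b'.z - b.z) b.z
    rw [sub_add_cancel] at this
    linarith
  have hAA : |area a.z b.z| / 2 < |area a'.z b'.z| := by
    have := abs_sub_abs_le_abs_sub (area a.z b.z) (area a'.z b'.z)
    rw [abs_sub_comm] at this
    linarith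
  have h0 := h'.z_eq_zero hd
    (((abs_area_le _ _).trans (mul_le_mul_of_nonneg_left hnb (norm_nonneg _))).trans_lt
      (hdz.trans hAA))
    (((abs_area_le _ _).trans (mul_le_mul_of_nonneg_right hna (norm_nonneg _))).trans_lt
      ((mul_comm _ _).trans_lt (hdz.trans hAA)))
  exact ⟨d.t, by rw [mem_centralPart, ← eq_central h0]; exact hd, hdt⟩

/-! ### Strata of lattices and failure of local connectedness -/

/-- The lattices for which `[Λ, Λ]` consists of the `k`-th multiples in `Λ ∩ Z`. -/
def stratum (k : ℕ) : Set (ClosedSubgroup Heisenberg) :=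
  {D | ∃ a b c, IsPlaneBasis D.toSubgroup a b ∧ 0 < c ∧
    centralPart D.toSubgroup = AddSubgroup.zmultiples c ∧ |area a.z b.z| = k * c}

theorem exists_mem_stratum {D : ClosedSubgroup Heisenberg} (hD : D ∈ lattices) :
    ∃ k, D ∈ stratum k := by
  obtain ⟨a, b, c, k, h, hc, hT, hk⟩ := exists_isPlaneBasis_of_mem_lattices hD
  refine ⟨k.natAbs, a, b, c, h, hc, hT, ?_⟩
  rw [hk, abs_mul, abs_of_pos hc, Nat.cast_natAbs, Int.cast_abs]

theorem le_of_mem_zmultiples {c t : ℝ} (hc : 0 < c) (ht : 0 < t) (h : t ∈ AddSubgroup.zmultiples c) :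
    c ≤ t := by
  obtain ⟨n, rfl⟩ := AddSubgroup.mem_zmultiples_iff.1 h
  rw [zsmul_eq_mul] at ht ⊢
  have hn : 0 < n := by
    have := pos_of_mul_pos_left ht hc.le
    exact_mod_cast this
  have : (1 : ℝ) ≤ n := by exact_mod_cast hn
  nlinarith

theorem eq_of_mem_stratum {j k : ℕ} {D : ClosedSubgroup Heisenberg} (hj : D ∈ stratum j)
    (hk : D ∈ stratum k) : j = k := by
  obtain ⟨a, b, c, h, hc, hT, hA⟩ := hj
  obtain ⟨a', b', c', h', hc', hT', hA'⟩ := hk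
  have h1 : c ≤ c' := le_of_mem_zmultiples hc hc' (by
    rw [← hT, hT']
    exact AddSubgroup.mem_zmultiples c')
  have h2 : c' ≤ c := le_of_mem_zmultiples hc' hc (by
    rw [← hT', hT]
    exact AddSubgroup.mem_zmultiples c)
  have h3 := h.abs_area_eq h'
  rw [hA, hA', le_antisymm h1 h2] at h3
  exact_mod_cast mul_right_cancel₀ hc'.ne' h3

/-- A nearby `D` has a central element `c'` close to `c`, and avoids the central elements in `[-c,
c]` that are far from all multiples of `c`. Halving shows that `c'` generates the central part of
`D`. The new area is then both an integral multiple of `c'` and close to `k * c` in absolute value.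
-/
theorem isOpen_stratum (k : ℕ) : IsOpen (stratum k) := by
  refine isOpen_iff_mem_nhds.2 fun C hC => ?_
  obtain ⟨a, b, c, h, hc, hT, hA⟩ := hC
  set K : Set Heisenberg := {x | x.z = 0 ∧ |x.t| ≤ c ∧ ∀ m : ℤ, c / 8 ≤ |x.t - m * c|} with hKdef
  have hK : IsCompact K := by
    refine isCompact_of_bounded (M := 0) (R := c) ?_ fun x hx => ⟨by simp [hx.1], hx.2.1⟩
    refine (isClosed_eq (by fun_prop) (by fun_prop)).and
      ((isClosed_le (by fun_prop) (by fun_prop)).and ?_)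
    rw [Set.ofPred_forall]
    exact isClosed_iInter fun m => isClosed_le (by fun_prop) (by fun_prop)
  have hCK : Disjoint (C : Set Heisenberg) K := by
    refine Set.disjoint_left.2 fun x hx hxK => ?_
    obtain ⟨h1, -, h2⟩ := hxK
    have : x.t ∈ centralPart C.toSubgroup := by
      rw [mem_centralPart, ← eq_central h1]
      exact hx
    rw [hT, AddSubgroup.mem_zmultiples_iff] at this
    obtain ⟨m, hm⟩ := this
    have := h2 m
    rw [← hm] at this
    simp at this
    linarith
  have hcC : c ∈ centralPart C.toSubgroup := hT ▸ AddSubgroup.mem_zmultiples c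
  have hk1 : (0 : ℝ) < k + 1 := by positivity
  filter_upwards [h.eventually (show 0 < c / 8 by positivity),
    -- The error in `c'` gets multiplied by `k` when `k * c` is compared with `k * c'`.
    h.eventually_centralPart hcC (show 0 < c / (8 * (k + 1)) by positivity),
    ClosedSubgroup.eventually_disjoint hK hCK]
  rintro D ⟨a', b', h', -, -, hA'⟩ ⟨c', hc', hcc'⟩ hDK
  have hcle : (k + 1) * |c' - c| < c / 8 := by
    rw [lt_div_iff₀ (by positivity)] at hcc'
    linarith
  have hcc8 : |c' - c| < c / 8 := by nlinarith [abs_nonneg (c' - c), (Nat.cast_nonneg k : (0 : ℝ) ≤ k)]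
  rw [abs_lt] at hcc8
  have hc'0 : 0 < c' := by linarith
  have hsmall : ∀ t ∈ centralPart D.toSubgroup, |t| ≤ c' / 2 → |t| < c' / 2 / 2 := by
    intro t ht htc
    have hnot : central t ∉ K := fun hK' => Set.disjoint_left.1 hDK (mem_centralPart.1 ht) hK'
    have : ∃ m : ℤ, |t - m * c| < c / 8 := by
      by_contra! hcon
      exact hnot ⟨rfl, by simp only [central_t]; linarith, hcon⟩
    obtain ⟨m, hm⟩ := this
    have hm0 : m = 0 := by
      apply int_eq_zero_of_abs_mul_lt (c := c)
      rw [abs_of_pos hc]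
      rw [abs_lt] at hm ⊢
      rw [abs_le] at htc
      constructor <;> linarith [hm.1, hm.2, htc.1, htc.2]
    rw [hm0] at hm
    simp only [Int.cast_zero, zero_mul, sub_zero] at hm
    linarith
  have hTD : centralPart D.toSubgroup = AddSubgroup.zmultiples c' := by
    refine le_antisymm (fun t ht => ?_) (by simpa using hc')
    have hmem : t - round (t / c') * c' ∈ centralPart D.toSubgroup := by
      refine sub_mem ht ?_
      simpa using zsmul_mem hc' (round (t / c'))
    have h0 := eq_zero_of_forall_le_imp_lt_half (T := centralPart D.toSubgroup) (N := fun t => |t|)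
      (fun z => by rw [← two_mul, abs_mul, abs_two]) (fun z => abs_nonneg z) hsmall hmem
      (by simpa [abs_of_pos hc'0] using abs_sub_round_mul_le hc'0.ne' t)
    exact ⟨round (t / c'), by simpa using (sub_eq_zero.1 (abs_eq_zero.1 h0)).symm⟩
  refine ⟨a', b', c', h', hc'0, hTD, ?_⟩
  have hm := area_mem_centralPart h'.1 h'.2.1
  rw [hTD, AddSubgroup.mem_zmultiples_iff] at hm
  obtain ⟨m, hm⟩ := hm
  rw [zsmul_eq_mul] at hm
  have e1 : |(|area a'.z b'.z| - |area a.z b.z|)| < c / 8 :=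
    (abs_abs_sub_abs_le_abs_sub _ _).trans_lt hA'
  have e3 : |area a'.z b'.z| = ((|m| : ℤ) : ℝ) * c' := by
    rw [← hm, abs_mul, abs_of_pos hc'0, Int.cast_abs]
  have e2 : |m| - (k : ℤ) = 0 := by
    apply int_eq_zero_of_abs_mul_lt (c := c')
    have e4 : ((|m| - (k : ℤ) : ℤ) : ℝ) * c' =
        (|area a'.z b'.z| - |area a.z b.z|) + k * (c - c') := by
      rw [e3, hA]
      push_cast
      ring
    rw [e4, abs_of_pos hc'0]
    refine (abs_add_le _ _).trans_lt ?_
    rw [abs_mul, abs_sub_comm c c', abs_of_nonneg (Nat.cast_nonneg k : (0 : ℝ) ≤ k)]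
    nlinarith [abs_nonneg (c' - c)]
  rw [e3, sub_eq_zero.1 e2]
  simp

/-- A nearby subgroup has very small positive central elements, while the area of its plane basis
stays above half that of `C`; so the ratio of area to central generator exceeds `k`. -/
theorem compl_stratum_mem_nhds {C : ClosedSubgroup Heisenberg} (hC : C ∈ latticesInfty) (k : ℕ) :
    (stratum k)ᶜ ∈ 𝓝 C := by
  obtain ⟨hT, a, b, h⟩ := mem_latticesInfty_iff.1 hC
  have hA : 0 < |area a.z b.z| := abs_pos.2 h.2.2.1
  -- Approximating the central coordinate `ε` within `ε / 2` gives `c < 2 * ε`, and `2 * k * ε` is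
  -- less than half the area.
  set ε := |area a.z b.z| / (4 * (k + 1)) with hεdef
  have hk1 : (0 : ℝ) < k + 1 := by positivity
  have hε : 0 < ε := by positivity
  have hεA : 4 * (k + 1) * ε = |area a.z b.z| := by
    rw [hεdef]
    field_simp
  filter_upwards [h.eventually (half_pos hA),
    h.eventually_centralPart (t := ε) (hT ▸ AddSubgroup.mem_top _) (half_pos hε)]
  rintro D ⟨a', b', h', -, -, hab⟩ ⟨t, ht, htε⟩ ⟨a'', b'', c, h'', hc, hTc, hk⟩
  rw [abs_lt] at htε
  have hct : c ≤ t := le_of_mem_zmultiples hc (by linarith) (hTc ▸ ht)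
  have hAA : |area a.z b.z| / 2 < |area a'.z b'.z| := by
    have := abs_sub_abs_le_abs_sub (area a.z b.z) (area a'.z b'.z)
    rw [abs_sub_comm] at this
    linarith
  rw [h'.abs_area_eq h'', hk] at hAA
  have : (k : ℝ) * c ≤ k * (2 * ε) := mul_le_mul_of_nonneg_left (by linarith) (Nat.cast_nonneg k)
  nlinarith

/-- A neighbourhood in `latticesBangBang` of a point of `latticesInfty` is disconnected by the
strata. -/
theorem not_isConnected_of_mem_nhds {C : ClosedSubgroup Heisenberg} (hC : C ∈ latticesInfty)
    (hcl : C ∈ closure lattices) {U : Set (ClosedSubgroup Heisenberg)} (hU : U ∈ 𝓝 C)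
    (hUL : U ⊆ latticesBangBang) : ¬ IsConnected U := by
  rintro ⟨-, hpre⟩
  obtain ⟨D, hDU, hD⟩ := mem_closure_iff_nhds.1 hcl U hU
  obtain ⟨k, hk⟩ := exists_mem_stratum hD
  -- Other lattices lie in other open strata, and points of `latticesInfty` have neighbourhoods
  -- missing `stratum k`.
  have hcov : U ⊆ stratum k ∪ interior (stratum k)ᶜ := by
    intro E hE
    rcases hUL hE with h | h
    · obtain ⟨j, hj⟩ := exists_mem_stratum h
      by_cases hjk : j = k
      · exact Or.inl (hjk ▸ hj)
      · refine Or.inr (mem_interior.2 ⟨stratum j, fun F hF hF' => hjk (eq_of_mem_stratum hF hF'),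
          isOpen_stratum j, hj⟩)
    · exact Or.inr (mem_interior_iff_mem_nhds.2 (compl_stratum_mem_nhds h k))
  obtain ⟨E, -, hE, hE'⟩ := hpre (stratum k) (interior (stratum k)ᶜ) (isOpen_stratum k)
    isOpen_interior hcov ⟨D, hDU, hk⟩
    ⟨C, mem_of_mem_nhds hU, mem_interior_iff_mem_nhds.2 (compl_stratum_mem_nhds hC k)⟩
  exact interior_subset hE' hE

end Heisenberg

/-! ### Limits of products and rescaled grids -/

namespace FellTendsto

variable {ι X Y : Type*} [TopologicalSpace X] [TopologicalSpace Y] {l : Filter ι}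

theorem const {E : Set X} (hE : IsClosed E) : FellTendsto (fun _ => E) l E :=
  ⟨fun x hx _ hO => Eventually.of_forall fun _ => ⟨x, hx, mem_of_mem_nhds hO⟩,
    fun _ hx => ⟨Eᶜ, hE.isOpen_compl.mem_nhds hx, Eventually.of_forall fun _ => disjoint_compl_right⟩⟩

theorem prod {F : ι → Set X} {E : Set X} {F' : ι → Set Y} {E' : Set Y} (h : FellTendsto F l E)
    (h' : FellTendsto F' l E') : FellTendsto (fun i => F i ×ˢ F' i) l (E ×ˢ E') := by
  refine ⟨?_, fun x hx => ?_⟩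
  · rintro ⟨x, y⟩ ⟨hx, hy⟩ O hO
    obtain ⟨A, hA, B, hB, hAB⟩ := mem_nhds_prod_iff.1 hO
    filter_upwards [h.1 x hx A hA, h'.1 y hy B hB] with i ⟨a, ha, haA⟩ ⟨b, hb, hbB⟩
    exact ⟨(a, b), ⟨ha, hb⟩, hAB ⟨haA, hbB⟩⟩
  · rw [Set.mem_prod, not_and_or] at hx
    rcases hx with hx | hx
    · obtain ⟨O, hO, hd⟩ := h.2 _ hx
      refine ⟨Prod.fst ⁻¹' O, continuous_fst.continuousAt hO, ?_⟩
      filter_upwards [hd] with i hi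
      exact Set.disjoint_left.2 fun y hy hyO => Set.disjoint_left.1 hi hy.1 hyO
    · obtain ⟨O, hO, hd⟩ := h'.2 _ hx
      refine ⟨Prod.snd ⁻¹' O, continuous_snd.continuousAt hO, ?_⟩
      filter_upwards [hd] with i hi
      exact Set.disjoint_left.2 fun y hy hyO => Set.disjoint_left.1 hi hy.2 hyO

end FellTendsto

theorem dense_setOf_ne_zero_and_ne_top : Dense {c : ℝ≥0∞ | c ≠ 0 ∧ c ≠ ⊤} := by
  have := (dense_univ (X := ℝ≥0∞)).sdiff_finset {0, ⊤}
  convert! this using 1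
  ext c
  simp

section Grid

open Module

variable {V : Type*} [NormedAddCommGroup V] [NormedSpace ℝ V]

theorem mem_gridSubgroup_one {b : Basis (Fin 2) ℝ V} {v : V} :
    v ∈ gridSubgroup b 1 ↔ ∃ m n : ℤ, v = (m : ℝ) • b 0 + (n : ℝ) • b 1 := by
  rw [mem_gridSubgroup, Fin.forall_fin_two]
  simp only [Pi.one_apply, mem_spacedSubgroup_one]
  constructor
  · rintro ⟨⟨m, hm⟩, ⟨n, hn⟩⟩
    refine ⟨m, n, ?_⟩
    rw [hm, hn, ← Fin.sum_univ_two (fun i => b.repr v i • b i), b.sum_repr]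
  · rintro ⟨m, n, rfl⟩
    exact ⟨⟨m, by simp⟩, ⟨n, by simp⟩⟩

/-- Finite nonzero spacings are absorbed into the basis vectors. -/
theorem exists_gridSubgroup_eq_one (b : Basis (Fin 2) ℝ V) {c : Fin 2 → ℝ≥0∞}
    (hc : ∀ i, c i ≠ 0 ∧ c i ≠ ⊤) : ∃ b', gridSubgroup b c = gridSubgroup b' 1 := by
  have hpos : ∀ i, (c i).toReal ≠ 0 := fun i => (ENNReal.toReal_pos (hc i).1 (hc i).2).ne'
  refine ⟨b.isUnitSMul fun i => (hpos i).isUnit, ?_⟩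
  ext v
  rw [mem_gridSubgroup_one]
  simp only [b.isUnitSMul_apply, smul_smul]
  rw [mem_gridSubgroup, Fin.forall_fin_two, mem_spacedSubgroup_of_ne_zero (hc 0).1,
    mem_spacedSubgroup_of_ne_zero (hc 1).1]
  constructor
  · rintro ⟨⟨m, hm⟩, ⟨n, hn⟩⟩
    refine ⟨m, n, ?_⟩
    rw [hm, hn, ← Fin.sum_univ_two (fun i => b.repr v i • b i), b.sum_repr]
  · rintro ⟨m, n, rfl⟩
    exact ⟨⟨m, by simp⟩, ⟨n, by simp⟩⟩

end Grid

namespace Heisenberg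

open Module

/-! ### Subgroups containing the centre as limits of lattices -/

section Tube

/-- The closed subgroup of the elements with plane coordinate in `E` and central coordinate
in `cℤ`. -/
noncomputable def closedCover (E : AddSubgroup ℂ) (hE : IsClosed (E : Set ℂ)) (c : ℝ≥0∞)
    (h : ∀ z ∈ E, ∀ w ∈ E, area z w / 2 ∈ spacedSubgroup c) : ClosedSubgroup Heisenberg where
  toSubgroup := cover E c h
  isClosed' := (hE.preimage continuous_z).inter ((isClosed_spacedSubgroup c).preimage continuous_t)

theorem coe_closedCover (E : AddSubgroup ℂ) (hE : IsClosed (E : Set ℂ)) (c : ℝ≥0∞)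
    (h : ∀ z ∈ E, ∀ w ∈ E, area z w / 2 ∈ spacedSubgroup c) :
    (closedCover E hE c h : Set Heisenberg) = homeo ⁻¹' ((E : Set ℂ) ×ˢ (spacedSubgroup c : Set ℝ)) :=
  rfl

/-- The closed subgroup of the elements with plane coordinate in `E`. -/
noncomputable def tube (E : AddSubgroup ℂ) (hE : IsClosed (E : Set ℂ)) :
    ClosedSubgroup Heisenberg :=
  closedCover E hE 0 fun _ _ _ _ => by rw [spacedSubgroup_zero]; trivial

theorem mem_tube {E : AddSubgroup ℂ} {hE : IsClosed (E : Set ℂ)} {x : Heisenberg} :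
    x ∈ (tube E hE).toSubgroup ↔ x.z ∈ E := by
  refine ⟨fun h => h.1, fun h => ⟨h, ?_⟩⟩
  rw [spacedSubgroup_zero]
  trivial

theorem continuous_tube_gridSubgroup (β : Basis (Fin 2) ℝ ℂ) :
    Continuous fun c => tube (gridSubgroup β c) (isClosed_gridSubgroup β c) := by
  refine continuous_iff_continuousAt.2 fun c => FellTendsto.tendsto_closedSubgroup ?_
  have h := (fellTendsto_gridSubgroup β c).preimage continuous_z
    (isOpenMap_fst.comp homeo.isOpenMap)
  convert h using 1
  · ext c' x
    exact mem_tube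
  · ext x
    exact mem_tube

theorem exists_eq_tube {D : ClosedSubgroup Heisenberg} (hT : centralPart D.toSubgroup = ⊤) :
    ∃ β c, D = tube (gridSubgroup β c) (isClosed_gridSubgroup β c) := by
  have hmem : ∀ x y : Heisenberg, x ∈ D.toSubgroup → x.z = y.z → y ∈ D.toSubgroup := by
    intro x y hx hxy
    have hc : central (y.t - x.t) ∈ D.toSubgroup := by
      rw [← mem_centralPart, hT]
      trivial
    have : y = x * central (y.t - x.t) := by
      rw [mul_central]
      exact Heisenberg.ext hxy.symm (by simp)
    rw [this]
    exact mul_mem hx hc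
  have hE : IsClosed (planePart D.toSubgroup : Set ℂ) := by
    convert! D.isClosed'.preimage (by fun_prop : Continuous fun z : ℂ => (⟨z, 0⟩ : Heisenberg)) using 1
    ext z
    exact ⟨fun ⟨x, hx, hxz⟩ => hmem x _ hx hxz, fun hz => ⟨_, hz, rfl⟩⟩
  obtain ⟨β, c, h⟩ := exists_eq_gridSubgroup Complex.finrank_real_complex hE
  refine ⟨β, c, ClosedSubgroup.toSubgroup_injective (Subgroup.ext fun x => ?_)⟩
  rw [mem_tube, ← h]
  exact ⟨fun hx => ⟨x, hx, rfl⟩, fun ⟨y, hy, hyx⟩ => hmem y x hy hyx⟩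

/-- The projection is kept and the centre refined: half the basis area is divided by `n + 1`, so
half of every area in the grid stays a multiple of the spacing while the centre fills up. -/
theorem tube_gridSubgroup_one_mem_closure (β : Basis (Fin 2) ℝ ℂ) :
    tube (gridSubgroup β 1) (isClosed_gridSubgroup β 1) ∈ closure lattices := by
  have hA := area_basis_ne_zero β
  set A := |area (β 0) (β 1)| / 2 with hAdef
  have hA0 : 0 < A := by positivity
  have hAn : ∀ n : ℕ, 0 < A / (n + 1) := fun n => by positivity
  have h : ∀ n : ℕ, ∀ z ∈ gridSubgroup β 1, ∀ w ∈ gridSubgroup β 1,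
      area z w / 2 ∈ spacedSubgroup (ENNReal.ofReal (A / (n + 1))) := by
    intro n z hz w hw
    obtain ⟨m, k, rfl⟩ := mem_gridSubgroup_one.1 hz
    obtain ⟨m', k', rfl⟩ := mem_gridSubgroup_one.1 hw
    have hn : (n + 1 : ℝ) ≠ 0 := by positivity
    rw [mem_spacedSubgroup_ofReal (hAn n)]
    simp only [Complex.real_smul, area_comb]
    rcases abs_choice (area (β 0) (β 1)) with h | h
    · refine ⟨(m * k' - k * m') * (n + 1), ?_⟩
      rw [hAdef, h]
      push_cast
      field_simp
    · refine ⟨-(m * k' - k * m') * (n + 1), ?_⟩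
      rw [hAdef, h]
      push_cast
      field_simp
  set F : ℕ → ClosedSubgroup Heisenberg := fun n =>
    closedCover (gridSubgroup β 1) (isClosed_gridSubgroup β 1) _ (h n) with hF
  have hc : Tendsto (fun n : ℕ => ENNReal.ofReal (A / (n + 1))) atTop (𝓝 0) := by
    have : Tendsto (fun n : ℕ => A / ((n : ℝ) + 1)) atTop (𝓝 0) := by
      simpa [div_eq_mul_inv] using tendsto_one_div_add_atTop_nhds_zero_nat.const_mul A
    simpa using ENNReal.tendsto_ofReal this
  have ht : Tendsto F atTop (𝓝 (tube (gridSubgroup β 1) (isClosed_gridSubgroup β 1))) := by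
    refine FellTendsto.tendsto_closedSubgroup ?_
    simp only [hF, tube, coe_closedCover]
    refine FellTendsto.preimage (FellTendsto.prod (FellTendsto.const (isClosed_gridSubgroup β 1)) ?_)
      homeo.continuous homeo.isOpenMap
    have h := fellTendsto_spacedSubgroup 0
    refine ⟨fun x hx O hO => hc.eventually (h.1 x hx O hO), fun x hx => ?_⟩
    obtain ⟨O, hO, h'⟩ := h.2 x hx
    exact ⟨O, hO, hc.eventually h'⟩
  refine mem_closure_of_tendsto ht (Eventually.of_forall fun n => mem_lattices_iff.2 ⟨?_, ?_⟩)
  · exact ⟨⟨β 0, 0⟩, ⟨mem_gridSubgroup_one.2 ⟨1, 0, by simp⟩, zero_mem _⟩,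
      ⟨β 1, 0⟩, ⟨mem_gridSubgroup_one.2 ⟨0, 1, by simp⟩, zero_mem _⟩, hA⟩
  · intro hT
    -- Half of the central spacing is not an integral multiple of it.
    have : A / (n + 1) / 2 ∈ centralPart (F n).toSubgroup := hT ▸ AddSubgroup.mem_top _
    change _ ∈ centralPart (cover _ _ (h n)) at this
    rw [centralPart_cover, mem_spacedSubgroup_ofReal (hAn n)] at this
    obtain ⟨k, hk⟩ := this
    have h1 : (k : ℝ) * 2 = 1 := by
      have := (hAn n).ne'
      field_simp at hk
      linarith
    have h2 : k * 2 = 1 := by exact_mod_cast h1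
    omega

theorem mem_closure_lattices_of_centralPart_eq_top {D : ClosedSubgroup Heisenberg}
    (hT : centralPart D.toSubgroup = ⊤) : D ∈ closure lattices := by
  obtain ⟨β, c, rfl⟩ := exists_eq_tube hT
  have hS : Dense (Set.pi univ fun _ : Fin 2 => {c : ℝ≥0∞ | c ≠ 0 ∧ c ≠ ⊤}) :=
    dense_pi _ fun _ _ => dense_setOf_ne_zero_and_ne_top
  rw [← closure_closure]
  refine map_mem_closure (continuous_tube_gridSubgroup β) (hS c) fun c hc => ?_
  obtain ⟨b', hb'⟩ := exists_gridSubgroup_eq_one β (fun i => hc i (mem_univ i))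
  simp only [hb']
  exact tube_gridSubgroup_one_mem_closure b'

end Tube

/-! ### Subgroups over a line as limits of lattices -/

section Strip

/-- The Euclidean scalar product of the plane. -/
noncomputable def dot (z w : ℂ) : ℝ := z.re * w.re + z.im * w.im

theorem dot_add_right (z w w' : ℂ) : dot z (w + w') = dot z w + dot z w' := by
  simp [dot]; ring

theorem dot_neg_right (z w : ℂ) : dot z (-w) = -dot z w := by
  simp [dot]; ring

theorem area_neg_right (z w : ℂ) : area z (-w) = -area z w := by
  simp [area]; ring

@[fun_prop]
theorem continuous_dot {X : Type*} [TopologicalSpace X] {f g : X → ℂ} (hf : Continuous f)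
    (hg : Continuous g) : Continuous fun x => dot (f x) (g x) := by
  unfold dot
  fun_prop

theorem area_eq_dot_mul {u : ℂ} (hu : dot u u = 1) (z w : ℂ) :
    area z w = dot u z * area u w - area u z * dot u w := by
  have : area z w = dot u u * area z w := by rw [hu, one_mul]
  rw [this]
  simp only [dot, area]
  ring

theorem eq_dot_mul {u : ℂ} (hu : dot u u = 1) {z : ℂ} (hz : area u z = 0) :
    z = (dot u z : ℝ) * u := by
  have h1 : z.re = dot u u * z.re := by rw [hu, one_mul]
  have h2 : z.im = dot u u * z.im := by rw [hu, one_mul]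
  simp only [dot, area] at h1 h2 hz
  apply Complex.ext
  · simp [dot]
    linear_combination h1 - u.im * hz
  · simp [dot]
    linear_combination h2 + u.re * hz

variable {u : ℂ}

/-- The closed embedding of `ℝ × ℝ` as the preimage of the line spanned by `u`. -/
noncomputable def stripMap (u : ℂ) (q : ℝ × ℝ) : Heisenberg := ⟨q.1 • u, q.2⟩

theorem isClosedEmbedding_stripMap (hu : dot u u = 1) : IsClosedEmbedding (stripMap u) := by
  have hu0 : u ≠ 0 := by
    rintro rfl
    simp [dot] at hu
  exact homeo.symm.isClosedEmbedding.comp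
    ((isClosedEmbedding_smul_left hu0).prodMap IsClosedEmbedding.id)

/-- The closed subgroup corresponding to `E` in the preimage of the line spanned by `u`. -/
noncomputable def strip (hu : dot u u = 1) (E : AddSubgroup (ℝ × ℝ))
    (hE : IsClosed (E : Set (ℝ × ℝ))) : ClosedSubgroup Heisenberg where
  carrier := {x | area u x.z = 0 ∧ (dot u x.z, x.t) ∈ E}
  one_mem' := by
    have h0 : ((0 : ℝ), (0 : ℝ)) ∈ E := zero_mem E
    refine ⟨by simp [area], ?_⟩
    convert h0 using 2
    · simp [dot]
    · simp
  mul_mem' := by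
    rintro x y ⟨hx, hx'⟩ ⟨hy, hy'⟩
    refine ⟨by rw [mul_z, area_add_right, hx, hy, add_zero], ?_⟩
    have h0 : area x.z y.z = 0 := by rw [area_eq_dot_mul hu, hx, hy]; ring
    rw [mul_t', h0, mul_z, dot_add_right, zero_div, add_zero]
    exact add_mem hx' hy'
  inv_mem' := by
    rintro x ⟨hx, hx'⟩
    refine ⟨by rw [inv_z, area_neg_right, hx, neg_zero], ?_⟩
    rw [inv_z, inv_t, dot_neg_right]
    exact neg_mem hx'
  isClosed' := (isClosed_eq (by fun_prop) (by fun_prop)).and (hE.preimage (by fun_prop))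

theorem mem_strip {hu : dot u u = 1} {E : AddSubgroup (ℝ × ℝ)} {hE : IsClosed (E : Set (ℝ × ℝ))}
    {x : Heisenberg} : x ∈ (strip hu E hE).toSubgroup ↔ area u x.z = 0 ∧ (dot u x.z, x.t) ∈ E :=
  Iff.rfl

theorem dot_smul_self (hu : dot u u = 1) (r : ℝ) : dot u (r • u) = r := by
  have : dot u (r • u) = r * dot u u := by simp [dot]; ring
  rw [this, hu, mul_one]

theorem area_smul_self (r : ℝ) : area u (r • u) = 0 := by
  simp [area]; ring

theorem coe_strip (hu : dot u u = 1) (E : AddSubgroup (ℝ × ℝ)) (hE : IsClosed (E : Set (ℝ × ℝ))) :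
    (strip hu E hE : Set Heisenberg) = stripMap u '' E := by
  ext x
  constructor
  · rintro ⟨h1, h2⟩
    refine ⟨_, h2, Heisenberg.ext ?_ rfl⟩
    simp only [stripMap, Complex.real_smul]
    exact (eq_dot_mul hu h1).symm
  · rintro ⟨⟨r, t⟩, h, rfl⟩
    refine ⟨area_smul_self r, ?_⟩
    simp only [stripMap, dot_smul_self hu]
    exact h

theorem tendsto_strip (hu : dot u u = 1) {ι : Type*} {l : Filter ι} {F : ι → AddSubgroup (ℝ × ℝ)}
    {hF : ∀ i, IsClosed (F i : Set (ℝ × ℝ))} {E : AddSubgroup (ℝ × ℝ)}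
    {hE : IsClosed (E : Set (ℝ × ℝ))} (h : FellTendsto (fun i => (F i : Set (ℝ × ℝ))) l E) :
    Tendsto (fun i => strip hu (F i) (hF i)) l (𝓝 (strip hu E hE)) := by
  refine FellTendsto.tendsto_closedSubgroup ?_
  simp only [coe_strip]
  exact h.image (isClosedEmbedding_stripMap hu)

theorem continuous_strip_gridSubgroup (hu : dot u u = 1) (β : Basis (Fin 2) ℝ (ℝ × ℝ)) :
    Continuous fun c => strip hu (gridSubgroup β c) (isClosed_gridSubgroup β c) :=
  continuous_iff_continuousAt.2 fun c => tendsto_strip hu (fellTendsto_gridSubgroup β c)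

/-- Vanishing areas force the projection into a line. Over a line the area form vanishes, so the
group law is addition on `ℝ × ℝ`, and closed subgroups of a plane are grids. -/
theorem exists_eq_strip {D : ClosedSubgroup Heisenberg}
    (hD : ∀ a ∈ D.toSubgroup, ∀ b ∈ D.toSubgroup, area a.z b.z = 0) :
    ∃ (u : ℂ) (hu : dot u u = 1), ∃ β c, D = strip hu (gridSubgroup β c) (isClosed_gridSubgroup β c) := by
  obtain ⟨u, hu, hDu⟩ : ∃ u : ℂ, dot u u = 1 ∧ ∀ x ∈ D.toSubgroup, area u x.z = 0 := by
    by_cases h : ∀ x ∈ D.toSubgroup, x.z = 0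
    · exact ⟨1, by simp [dot], fun x hx => by simp [h x hx, area]⟩
    · push Not at h
      obtain ⟨a, ha, ha0⟩ := h
      have hn : ‖a.z‖ ≠ 0 := norm_ne_zero_iff.2 ha0
      refine ⟨(‖a.z‖⁻¹ : ℝ) * a.z, ?_, fun x hx => ?_⟩
      · have h1 : ‖a.z‖ ^ 2 = a.z.re * a.z.re + a.z.im * a.z.im := by
          rw [← Complex.normSq_eq_norm_sq, Complex.normSq_apply]
        have h2 : dot ((‖a.z‖⁻¹ : ℝ) * a.z) ((‖a.z‖⁻¹ : ℝ) * a.z) = (‖a.z‖⁻¹) ^ 2 * ‖a.z‖ ^ 2 := by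
          rw [h1]
          simp only [dot, Complex.re_ofReal_mul, Complex.im_ofReal_mul]
          ring
        rw [h2, ← mul_pow, inv_mul_cancel₀ hn, one_pow]
      · rw [area_smul_left, hD a ha x hx, mul_zero]
  let E : AddSubgroup (ℝ × ℝ) :=
    { carrier := {q | stripMap u q ∈ D.toSubgroup}
      zero_mem' := by
        have : stripMap u 0 = 1 := by ext <;> simp [stripMap]
        rw [Set.mem_ofPred_eq, this]
        exact one_mem _
      add_mem' := by
        rintro q q' hq hq'
        have : stripMap u (q + q') = stripMap u q * stripMap u q' := by
          apply Heisenberg.ext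
          · simp [stripMap, add_mul]
          · rw [mul_t']
            simp [stripMap, area]
            ring
        rw [Set.mem_ofPred_eq, this]
        exact mul_mem hq hq'
      neg_mem' := by
        rintro q hq
        have : stripMap u (-q) = (stripMap u q)⁻¹ := by ext <;> simp [stripMap]
        rw [Set.mem_ofPred_eq, this]
        exact inv_mem hq }
  have hE : IsClosed (E : Set (ℝ × ℝ)) := D.isClosed'.preimage (isClosedEmbedding_stripMap hu).continuous
  obtain ⟨β, c, h⟩ := exists_eq_gridSubgroup (by simp) hE
  refine ⟨u, hu, β, c, ClosedSubgroup.toSubgroup_injective (Subgroup.ext fun x => ?_)⟩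
  rw [mem_strip, ← h]
  have key : area u x.z = 0 → stripMap u (dot u x.z, x.t) = x := fun h0 => by
    refine Heisenberg.ext ?_ rfl
    simp only [stripMap, Complex.real_smul]
    exact (eq_dot_mul hu h0).symm
  constructor
  · intro hx
    refine ⟨hDu x hx, ?_⟩
    change stripMap u (dot u x.z, x.t) ∈ D.toSubgroup
    rwa [key (hDu x hx)]
  · rintro ⟨h0, h1⟩
    rw [← key h0]
    exact h1

/-- The closed subgroup generated by a strip and an element orthogonal to it. -/
noncomputable def twistedStrip (hu : dot u u = 1) (E : AddSubgroup (ℝ × ℝ))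
    (hE : IsClosed (E : Set (ℝ × ℝ))) (N : ℝ)
    (h : ∀ q ∈ E, ((0 : ℝ), N * q.1) ∈ E) : ClosedSubgroup Heisenberg where
  -- Each element is a strip element times a power of `(N * I * u, 0)`; subtracting half of `area u
  -- x.z * dot u x.z` recovers the central coordinate of the strip factor.
  carrier := {x | area u x.z ∈ AddSubgroup.zmultiples N ∧
    (dot u x.z, x.t - area u x.z * dot u x.z / 2) ∈ E}
  one_mem' := by
    have h0 : ((0 : ℝ), (0 : ℝ)) ∈ E := zero_mem E
    refine ⟨by simp [area], ?_⟩
    convert h0 using 2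
    · simp [dot]
    · simp [dot, area]
  mul_mem' := by
    rintro x y ⟨hx, hx'⟩ ⟨hy, hy'⟩
    refine ⟨by rw [mul_z, area_add_right]; exact add_mem hx hy, ?_⟩
    have hz := area_eq_dot_mul hu x.z y.z
    obtain ⟨m, hm⟩ := AddSubgroup.mem_zmultiples_iff.1 hy
    have h2 := zsmul_mem (h _ hx') m
    obtain ⟨m', hm'⟩ := AddSubgroup.mem_zmultiples_iff.1 hx
    have h3 := zsmul_mem (h _ hy') m'
    -- Moving the transverse factor of `x` past the strip factor of `y` costs `area u x.z * dot u
    -- y.z`, an integral multiple of the vertical vector supplied by `h`.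
    convert add_mem (add_mem hx' hy') (neg_mem h3) using 1
    rw [zsmul_eq_mul] at hm hm'
    refine Prod.ext ?_ ?_
    · simp [dot_add_right]
    · simp only [mul_t', mul_z, area_add_right, dot_add_right, hz, Prod.snd_add, Prod.snd_neg,
        Prod.smul_mk, zsmul_eq_mul]
      rw [← mul_assoc, hm']
      ring
  inv_mem' := by
    rintro x ⟨hx, hx'⟩
    obtain ⟨m', hm'⟩ := AddSubgroup.mem_zmultiples_iff.1 hx
    have h3 := zsmul_mem (h _ hx') m'
    refine ⟨by rw [inv_z, area_neg_right]; exact neg_mem hx, ?_⟩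
    convert sub_mem (neg_mem hx') h3 using 1
    rw [zsmul_eq_mul] at hm'
    refine Prod.ext ?_ ?_
    · simp [dot_neg_right]
    · simp only [inv_t, inv_z, area_neg_right, dot_neg_right, Prod.snd_sub, Prod.snd_neg,
        Prod.smul_mk, zsmul_eq_mul]
      rw [← mul_assoc, hm']
      ring
  isClosed' := by
    have : IsClosed (AddSubgroup.zmultiples N : Set ℝ) := AddSubgroup.isClosed_of_discrete
    exact (this.preimage (by fun_prop : Continuous fun x : Heisenberg => area u x.z)).and
      (hE.preimage (by fun_prop))

theorem mem_twistedStrip {hu : dot u u = 1} {E : AddSubgroup (ℝ × ℝ)}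
    {hE : IsClosed (E : Set (ℝ × ℝ))} {N : ℝ} {h : ∀ q ∈ E, ((0 : ℝ), N * q.1) ∈ E}
    {x : Heisenberg} : x ∈ (twistedStrip hu E hE N h).toSubgroup ↔
      area u x.z ∈ AddSubgroup.zmultiples N ∧
        (dot u x.z, x.t - area u x.z * dot u x.z / 2) ∈ E := Iff.rfl

/-- Elements outside the strip itself have transverse coordinate at least `|N i|` in absolute value,
so they leave every compact set. -/
theorem tendsto_twistedStrip (hu : dot u u = 1) {E : AddSubgroup (ℝ × ℝ)}
    {hE : IsClosed (E : Set (ℝ × ℝ))} {ι : Type*} {l : Filter ι} {N : ι → ℝ}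
    {h : ∀ i, ∀ q ∈ E, ((0 : ℝ), N i * q.1) ∈ E} (hN : Tendsto (fun i => |N i|) l atTop) :
    Tendsto (fun i => twistedStrip hu E hE (N i) (h i)) l (𝓝 (strip hu E hE)) := by
  refine FellTendsto.tendsto_closedSubgroup ⟨fun x hx O hO => Eventually.of_forall fun i =>
    ⟨x, ?_, mem_of_mem_nhds hO⟩, fun x hx => ?_⟩
  · obtain ⟨h1, h2⟩ := hx
    refine mem_twistedStrip.2 ⟨by simp [h1], ?_⟩
    rw [h1, zero_mul, zero_div, sub_zero]
    exact h2
  · refine ⟨(strip hu E hE : Set Heisenberg)ᶜ ∩ {y | |area u y.z| < |area u x.z| + 1}, ?_, ?_⟩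
    · exact inter_mem ((strip hu E hE).isClosed'.isOpen_compl.mem_nhds hx)
        ((isOpen_lt (by fun_prop) (by fun_prop)).mem_nhds (by simp))
    · filter_upwards [hN.eventually_ge_atTop (|area u x.z| + 1)] with i hi
      refine Set.disjoint_left.2 fun y hy hyO => ?_
      obtain ⟨h1, h2⟩ := mem_twistedStrip.1 hy
      have h3 : |area u y.z| < |N i| := lt_of_lt_of_le hyO.2 hi
      obtain ⟨m, hm⟩ := AddSubgroup.mem_zmultiples_iff.1 h1
      rw [zsmul_eq_mul] at hm
      rw [← hm] at h3
      rw [int_eq_zero_of_abs_mul_lt h3] at hm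
      have h0 : area u y.z = 0 := by rw [← hm]; simp
      refine hyO.1 ⟨h0, ?_⟩
      rw [h0, zero_mul, zero_div, sub_zero] at h2
      exact h2

theorem exists_not_mem_gridSubgroup_one (β : Basis (Fin 2) ℝ (ℝ × ℝ)) :
    ∃ t : ℝ, ((0 : ℝ), t) ∉ gridSubgroup β 1 := by
  by_contra! h
  have h0 : β.repr ((0 : ℝ), (1 : ℝ)) ≠ 0 := by
    rw [Ne, β.repr.map_eq_zero_iff]
    simp
  obtain ⟨i, hi⟩ := Finsupp.ne_iff.1 h0
  rw [Finsupp.zero_apply] at hi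
  have h1 := h (1 / (2 * β.repr ((0 : ℝ), (1 : ℝ)) i))
  have h2 : ((0 : ℝ), 1 / (2 * β.repr ((0 : ℝ), (1 : ℝ)) i)) =
      (1 / (2 * β.repr ((0 : ℝ), (1 : ℝ)) i)) • ((0 : ℝ), (1 : ℝ)) := by simp
  rw [h2, mem_gridSubgroup] at h1
  have h3 := h1 i
  rw [Pi.one_apply, mem_spacedSubgroup_one] at h3
  obtain ⟨n, hn⟩ := h3
  rw [map_smul, Finsupp.smul_apply, smul_eq_mul] at hn
  have h4 : (n : ℝ) * 2 = 1 := by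
    rw [hn]
    field_simp
  have h5 : n * 2 = 1 := by exact_mod_cast h4
  omega

/-- Commensurability gives `E` a nonzero vertical vector and makes its first coordinates multiples
of a common length. Suitable transverse translations, as large as desired, then have all their
commutators with `E` inside `E`. -/
theorem strip_mem_closure_of_commensurable (hu : dot u u = 1) {β : Basis (Fin 2) ℝ (ℝ × ℝ)}
    {p q : ℤ} (hpq : p ≠ 0 ∨ q ≠ 0) (h : p * (β 0).1 = q * (β 1).1) :
    strip hu (gridSubgroup β 1) (isClosed_gridSubgroup β 1) ∈ closure lattices := by
  set E := gridSubgroup β 1 with hEdef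
  have hne : (β 0).1 ≠ 0 ∨ (β 1).1 ≠ 0 := by
    by_contra! hcon
    have h1 := β.sum_repr ((1 : ℝ), (0 : ℝ))
    rw [Fin.sum_univ_two] at h1
    have := congrArg Prod.fst h1
    simp [hcon.1, hcon.2] at this
  obtain ⟨g, hg, hg0, hg1⟩ : ∃ g : ℝ, g ≠ 0 ∧ (β 0).1 = q * g ∧ (β 1).1 = p * g := by
    by_cases hq : q = 0
    · have hp : (p : ℝ) ≠ 0 := by exact_mod_cast hpq.resolve_right (not_not.2 hq)
      have h0 : (β 0).1 = 0 := by
        rw [hq, Int.cast_zero, zero_mul] at h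
        exact (mul_eq_zero.1 h).resolve_left hp
      exact ⟨(β 1).1 / p, div_ne_zero (hne.resolve_left (not_not.2 h0)) hp, by simp [hq, h0],
        by field_simp⟩
    · have hq' : (q : ℝ) ≠ 0 := by exact_mod_cast hq
      have h0 : (β 0).1 ≠ 0 := by
        intro h0
        rw [h0, mul_zero] at h
        exact (mul_ne_zero hq' (hne.resolve_left (not_not.2 h0))) h.symm
      refine ⟨(β 0).1 / q, div_ne_zero h0 hq', by field_simp, ?_⟩
      field_simp
      linarith
  set τ := p * (β 0).2 - q * (β 1).2 with hτdef
  have hτE : ((0 : ℝ), τ) = ((p : ℤ) : ℝ) • β 0 + ((-q : ℤ) : ℝ) • β 1 := by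
    refine Prod.ext ?_ ?_
    · simp
      linarith
    · simp [hτdef]
      ring
  have hτ : τ ≠ 0 := by
    intro h0
    have h1 := congrArg β.repr hτE
    have e : β.repr ((0 : ℝ), (0 : ℝ)) = 0 := map_zero β.repr
    rw [h0, e] at h1
    have h2 := DFunLike.congr_fun h1 0
    have h3 := DFunLike.congr_fun h1 1
    simp at h2 h3
    rcases hpq with h | h
    · exact h (by exact_mod_cast h2.symm)
    · exact h (by exact_mod_cast h3)
  have hEmem : ∀ k : ℤ, ((0 : ℝ), k * τ) ∈ E := by
    intro k
    have := zsmul_mem (mem_gridSubgroup_one.2 ⟨p, -q, hτE⟩) k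
    simpa using this
  -- First coordinates of `E` are multiples of `g`, so `N j` times such a coordinate is a multiple
  -- of `τ`; the shift by one keeps `N j` nonzero.
  set N : ℕ → ℝ := fun j => (j + 1) * (τ / g) with hN
  have hNE : ∀ j, ∀ v ∈ E, ((0 : ℝ), N j * v.1) ∈ E := by
    intro j v hv
    obtain ⟨m, n, rfl⟩ := mem_gridSubgroup_one.1 hv
    convert hEmem ((j + 1) * (m * q + n * p)) using 2
    simp only [hN, Prod.fst_add, Prod.smul_fst, hg0, hg1, smul_eq_mul]
    push_cast
    field_simp
  have hNt : Tendsto (fun j => |N j|) atTop atTop := by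
    have h1 : Tendsto (fun j : ℕ => ((j : ℝ) + 1) * |τ / g|) atTop atTop :=
      (tendsto_atTop_add_const_right _ _ tendsto_natCast_atTop_atTop).atTop_mul_const
        (abs_pos.2 (div_ne_zero hτ hg))
    refine h1.congr fun j => ?_
    rw [hN, abs_mul, abs_of_pos (by positivity : (0 : ℝ) < j + 1)]
  refine mem_closure_of_tendsto (tendsto_twistedStrip hu (h := hNE) hNt)
    (Eventually.of_forall fun j => mem_lattices_iff.2 ⟨?_, ?_⟩)
  · have hNj : N j ≠ 0 := mul_ne_zero (by positivity) (div_ne_zero hτ hg)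
    have hb : (⟨(N j : ℝ) * (Complex.I * u), 0⟩ : Heisenberg) ∈
        (twistedStrip hu E (isClosed_gridSubgroup β 1) (N j) (hNE j)).toSubgroup := by
      have h1 : area u ((N j : ℝ) * (Complex.I * u)) = N j := by
        have : area u ((N j : ℝ) * (Complex.I * u)) = N j * dot u u := by
          simp [area, dot]; ring
        rw [this, hu, mul_one]
      have h2 : dot u ((N j : ℝ) * (Complex.I * u)) = 0 := by
        simp [dot]; ring
      refine mem_twistedStrip.2 ⟨?_, ?_⟩
      · simp only [h1]
        exact AddSubgroup.mem_zmultiples _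
      · simp only [h2, mul_zero, zero_div, sub_zero]
        exact zero_mem E
    have ha : ∀ v ∈ E, stripMap u v ∈
        (twistedStrip hu E (isClosed_gridSubgroup β 1) (N j) (hNE j)).toSubgroup := by
      intro v hv
      refine mem_twistedStrip.2 ⟨?_, ?_⟩
      · simp only [stripMap, area_smul_self]
        exact zero_mem _
      · simp only [stripMap, area_smul_self, dot_smul_self hu]
        simpa using hv
    have hab : ∀ v : ℝ × ℝ, area (stripMap u v).z ((N j : ℝ) * (Complex.I * u)) = v.1 * N j := by
      intro v
      have : area (stripMap u v).z ((N j : ℝ) * (Complex.I * u)) = v.1 * N j * dot u u := by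
        simp [area, dot, stripMap]; ring
      rw [this, hu, mul_one]
    rcases hne with h0 | h0
    · exact ⟨_, ha _ (mem_gridSubgroup_one.2 ⟨1, 0, by simp⟩ : β 0 ∈ E), _, hb, by
        rw [hab]; exact mul_ne_zero h0 hNj⟩
    · exact ⟨_, ha _ (mem_gridSubgroup_one.2 ⟨0, 1, by simp⟩ : β 1 ∈ E), _, hb, by
        rw [hab]; exact mul_ne_zero h0 hNj⟩
  · intro hT
    obtain ⟨t, ht⟩ := exists_not_mem_gridSubgroup_one β
    have : central t ∈ (twistedStrip hu E (isClosed_gridSubgroup β 1) (N j) (hNE j)).toSubgroup :=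
      mem_centralPart.1 (hT ▸ AddSubgroup.mem_top t)
    have h1 := (mem_twistedStrip.1 this).2
    simp [area, dot] at h1
    exact ht h1

/-- The shear `(r, t) ↦ (r + δ t, t)`. -/
noncomputable def shear (δ : ℝ) : (ℝ × ℝ) ≃ₗ[ℝ] (ℝ × ℝ) where
  toFun q := (q.1 + δ * q.2, q.2)
  invFun q := (q.1 - δ * q.2, q.2)
  left_inv q := by simp
  right_inv q := by simp
  map_add' q q' := by
    refine Prod.ext ?_ rfl
    simp
    ring
  map_smul' r q := by
    refine Prod.ext ?_ rfl
    simp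
    ring

theorem fellTendsto_shear (β : Basis (Fin 2) ℝ (ℝ × ℝ)) {ι : Type*} {l : Filter ι} {δ : ι → ℝ}
    (hδ : Tendsto δ l (𝓝 0)) :
    FellTendsto (fun i => (gridSubgroup (β.map (shear (δ i))) 1 : Set (ℝ × ℝ))) l
      (gridSubgroup β 1) := by
  have h := FellTendsto.preimage_of_tendsto (l := l) (isClosed_gridSubgroup β 1)
    (θ := fun i => (shear (δ i)).symm) (θ' := fun i => shear (δ i)) (φ := id) (φ' := id)
    (Eventually.of_forall fun i y => (shear (δ i)).symm_apply_apply y) (fun _ => rfl)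
    (fun x => ?_) (fun y => ?_)
  · exact h
  · have h1 : Tendsto (fun q : ι × (ℝ × ℝ) => δ q.1) (l ×ˢ 𝓝 x) (𝓝 0) := hδ.comp tendsto_fst
    have h2 : Tendsto (fun q : ι × (ℝ × ℝ) => q.2.1) (l ×ˢ 𝓝 x) (𝓝 x.1) :=
      (continuous_fst.tendsto x).comp tendsto_snd
    have h3 : Tendsto (fun q : ι × (ℝ × ℝ) => q.2.2) (l ×ˢ 𝓝 x) (𝓝 x.2) :=
      (continuous_snd.tendsto x).comp tendsto_snd
    have := (h2.sub (h1.mul h3)).prodMk_nhds h3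
    rw [zero_mul, sub_zero] at this
    exact this
  · have := ((hδ.mul_const y.2).const_add y.1).prodMk_nhds (tendsto_const_nhds (x := y.2))
    rw [zero_mul, add_zero] at this
    exact this

/-- Arbitrarily small shears make the ratio of the first coordinates of the two basis vectors
rational. -/
theorem strip_gridSubgroup_one_mem_closure (hu : dot u u = 1) (β : Basis (Fin 2) ℝ (ℝ × ℝ)) :
    strip hu (gridSubgroup β 1) (isClosed_gridSubgroup β 1) ∈ closure lattices := by
  by_cases hx0 : (β 0).1 = 0
  · exact strip_mem_closure_of_commensurable hu (p := 1) (q := 0) (by simp) (by simp [hx0])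
  -- Linear independence keeps the denominator of the shear parameter away from zero near `ρ₀`.
  have hdet : (β 1).1 * (β 0).2 - (β 0).1 * (β 1).2 ≠ 0 := by
    intro h0
    have hrel : (β 1).1 • β 0 + (-(β 0).1) • β 1 = 0 := by
      refine Prod.ext ?_ ?_
      · simp
        ring
      · simp
        linarith
    have h1 := congrArg (fun v => β.repr v 1) hrel
    simp at h1
    exact hx0 h1
  set ρ₀ := (β 1).1 / (β 0).1 with hρ₀
  let l : Filter ℚ := comap ((↑) : ℚ → ℝ) (𝓝 ρ₀)
  have hl : l.NeBot := Rat.isDenseEmbedding_coe_real.isDenseInducing.comap_nhds_neBot ρ₀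
  have hρ : Tendsto ((↑) : ℚ → ℝ) l (𝓝 ρ₀) := tendsto_comap
  have hden : Tendsto (fun ρ : ℚ => (ρ : ℝ) * (β 0).2 - (β 1).2) l (𝓝 (ρ₀ * (β 0).2 - (β 1).2)) :=
    (hρ.mul_const _).sub_const _
  have hden0 : ρ₀ * (β 0).2 - (β 1).2 ≠ 0 := by
    have : ρ₀ * (β 0).2 - (β 1).2 = ((β 1).1 * (β 0).2 - (β 0).1 * (β 1).2) / (β 0).1 := by
      rw [hρ₀]
      field_simp
    rw [this]
    exact div_ne_zero hdet hx0
  -- This `δ` solves `(β 1).1 + δ * (β 1).2 = ρ * ((β 0).1 + δ * (β 0).2)`.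
  have hδ : Tendsto (fun ρ : ℚ => ((β 1).1 - ρ * (β 0).1) / ((ρ : ℝ) * (β 0).2 - (β 1).2)) l (𝓝 0) := by
    have := ((hρ.mul_const (β 0).1).const_sub (β 1).1).div hden hden0
    have e : (β 1).1 - ρ₀ * (β 0).1 = 0 := by
      rw [hρ₀]
      field_simp
      ring
    rwa [e, zero_div] at this
  rw [← closure_closure]
  refine mem_closure_of_tendsto (tendsto_strip hu (hF := fun i => isClosed_gridSubgroup _ _)
    (fellTendsto_shear β hδ)) ?_
  filter_upwards [hden.eventually_ne hden0] with ρ hρ0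
  refine strip_mem_closure_of_commensurable hu (p := ρ.num) (q := ρ.den) (Or.inr (by simp)) ?_
  have hρq : (ρ : ℝ) * ρ.den = ρ.num := by exact_mod_cast Rat.mul_den_eq_num ρ
  have hd : (ρ.den : ℝ) ≠ 0 := by simp
  simp only [Basis.map_apply, shear, LinearEquiv.coe_mk, LinearMap.coe_mk, AddHom.coe_mk]
  rw [← hρq]
  push_cast
  field_simp
  ring

/-- Finite nonzero spacings are dense in `[0, ∞]`, and the strip depends continuously on its
spacings. -/
theorem strip_mem_closure_lattices (hu : dot u u = 1) (β : Basis (Fin 2) ℝ (ℝ × ℝ))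
    (c : Fin 2 → ℝ≥0∞) :
    strip hu (gridSubgroup β c) (isClosed_gridSubgroup β c) ∈ closure lattices := by
  have hS : Dense (Set.pi univ fun _ : Fin 2 => {c : ℝ≥0∞ | c ≠ 0 ∧ c ≠ ⊤}) :=
    dense_pi _ fun _ _ => dense_setOf_ne_zero_and_ne_top
  rw [← closure_closure]
  refine map_mem_closure (continuous_strip_gridSubgroup hu β) (hS c) fun c hc => ?_
  obtain ⟨b', hb'⟩ := exists_gridSubgroup_eq_one β (fun i => hc i (mem_univ i))
  simp only [hb']
  exact strip_gridSubgroup_one_mem_closure hu b'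

end Strip

theorem dense_lattices : Dense lattices := by
  intro D
  by_cases h : ∀ a ∈ D.toSubgroup, ∀ b ∈ D.toSubgroup, area a.z b.z = 0
  · obtain ⟨u, hu, β, c, rfl⟩ := exists_eq_strip h
    exact strip_mem_closure_lattices hu β c
  by_cases hT : centralPart D.toSubgroup = ⊤
  · exact mem_closure_lattices_of_centralPart_eq_top hT
  · push Not at h
    exact subset_closure (mem_lattices_iff.2 ⟨h, hT⟩)

end Heisenberg

/-! ### Path-connectedness -/

instance ENNReal.instPathConnectedSpace : PathConnectedSpace ℝ≥0∞ := by
  have : PathConnectedSpace (Icc (0 : ℝ) 1) :=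
    isPathConnected_iff_pathConnectedSpace.1
      ((convex_Icc (0 : ℝ) 1).isPathConnected ⟨0, by simp⟩)
  let e := ENNReal.orderIsoUnitIntervalBirational.toHomeomorph.symm
  exact e.surjective.pathConnectedSpace e.continuous

theorem Continuous.joined_apply {X Y : Type*} [TopologicalSpace X] [TopologicalSpace Y]
    [PathConnectedSpace X] {f : X → Y} (hf : Continuous f) (x y : X) : Joined (f x) (f y) :=
  ⟨(PathConnectedSpace.somePath x y).map hf⟩

namespace Heisenberg

open Module

/-- The trivial subgroup, as a closed subgroup. -/
noncomputable def closedBot : ClosedSubgroup Heisenberg := ⟨⊥, isClosed_singleton⟩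

theorem mem_closedBot {x : Heisenberg} : x ∈ closedBot.toSubgroup ↔ x = 1 := Subgroup.mem_bot

/-- Both spacings of the grid are moved to `⊤` along a path. -/
theorem joined_closedBot_of_area_eq_zero {D : ClosedSubgroup Heisenberg}
    (hD : ∀ a ∈ D.toSubgroup, ∀ b ∈ D.toSubgroup, area a.z b.z = 0) : Joined D closedBot := by
  obtain ⟨u, hu, β, c, rfl⟩ := exists_eq_strip hD
  have : strip hu (gridSubgroup β fun _ => ⊤) (isClosed_gridSubgroup β _) = closedBot := by
    refine ClosedSubgroup.toSubgroup_injective (Subgroup.ext fun x => ?_)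
    rw [mem_strip, mem_closedBot, mem_gridSubgroup]
    simp only [spacedSubgroup_top, AddSubgroup.mem_bot]
    constructor
    · rintro ⟨h1, h2⟩
      have h3 : β.repr (dot u x.z, x.t) = 0 := Finsupp.ext h2
      rw [β.repr.map_eq_zero_iff, Prod.mk_eq_zero] at h3
      refine Heisenberg.ext ?_ h3.2
      rw [eq_dot_mul hu h1, h3.1]
      simp
    · rintro rfl
      have h3 : (dot u (1 : Heisenberg).z, (1 : Heisenberg).t) = 0 := by simp [dot]
      rw [h3]
      exact ⟨by simp [area], by simp⟩
  rw [← this]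
  exact (continuous_strip_gridSubgroup hu β).joined_apply c _

/-- Moving the spacings of the projection to `⊤` leaves the centre, which is itself a strip. -/
theorem joined_closedBot_of_centralPart_eq_top {D : ClosedSubgroup Heisenberg}
    (hT : centralPart D.toSubgroup = ⊤) : Joined D closedBot := by
  obtain ⟨β, c, rfl⟩ := exists_eq_tube hT
  refine ((continuous_tube_gridSubgroup β).joined_apply c fun _ => ⊤).trans
    (joined_closedBot_of_area_eq_zero fun a ha b _ => ?_)
  have h0 : a.z = 0 := by
    have h1 := mem_tube.1 ha
    rw [mem_gridSubgroup] at h1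
    simp only [spacedSubgroup_top, AddSubgroup.mem_bot] at h1
    exact β.repr.map_eq_zero_iff.1 (Finsupp.ext h1)
  simp [h0, area]

/-- The dilation `(z, t) ↦ (r z, r² t)`. -/
noncomputable def dilation (r : ℝ) : Heisenberg →* Heisenberg where
  toFun x := ⟨r * x.z, r ^ 2 * x.t⟩
  map_one' := by ext <;> simp
  map_mul' x y := by
    apply Heisenberg.ext
    · simp [mul_add]
    · simp only [mul_t', area_smul_left, area_smul_right]
      ring

theorem dilation_apply (r : ℝ) (x : Heisenberg) : dilation r x = ⟨r * x.z, r ^ 2 * x.t⟩ := rfl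

theorem continuous_dilation : Continuous fun q : ℝ × Heisenberg => dilation q.1 q.2 := by
  simp only [dilation_apply]
  fun_prop

theorem dilation_dilation_inv {r : ℝ} (hr : r ≠ 0) (x : Heisenberg) :
    dilation r (dilation r⁻¹ x) = x := by
  have hr' : (r : ℂ) ≠ 0 := by exact_mod_cast hr
  apply Heisenberg.ext
  · simp only [dilation_apply]
    push_cast
    field_simp
  · simp only [dilation_apply]
    field_simp

open Classical in
/-- The dilates of `D`, degenerating to the trivial subgroup for `r = 0`. -/
noncomputable def dilate (D : ClosedSubgroup Heisenberg) (r : ℝ) : ClosedSubgroup Heisenberg :=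
  if r = 0 then closedBot else
    ⟨D.toSubgroup.comap (dilation r),
      D.isClosed'.preimage (continuous_dilation.comp (by fun_prop : Continuous fun x => (r, x)))⟩

theorem dilate_zero (D : ClosedSubgroup Heisenberg) : dilate D 0 = closedBot := if_pos rfl

theorem coe_dilate {D : ClosedSubgroup Heisenberg} {r : ℝ} (hr : r ≠ 0) :
    (dilate D r : Set Heisenberg) = dilation r ⁻¹' D := by
  rw [dilate, if_neg hr]
  rfl

theorem dilate_one (D : ClosedSubgroup Heisenberg) : dilate D 1 = D := by
  refine SetLike.coe_injective ?_
  rw [coe_dilate one_ne_zero]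
  ext x
  simp [dilation_apply]

/-- Discreteness is needed only at `0`: for small `r` the dilation carries a neighbourhood of a
given point close to `1`, where `D` has no other element. At nonzero parameters the dilations and
their inverses vary continuously. -/
theorem continuous_dilate {D : ClosedSubgroup Heisenberg} (hD : DiscreteTopology D.toSubgroup) :
    Continuous (dilate D) := by
  refine continuous_iff_continuousAt.2 fun r₀ => FellTendsto.tendsto_closedSubgroup ?_
  by_cases hr₀ : r₀ = 0
  · rw [hr₀, dilate_zero]
    have h1 : IsOpen ({1} : Set D.toSubgroup) := isOpen_discrete _
    obtain ⟨W, hW, hW1⟩ := isOpen_induced_iff.1 h1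
    have h1W : (1 : Heisenberg) ∈ W := by
      have : (1 : D.toSubgroup) ∈ Subtype.val ⁻¹' W := by rw [hW1]; rfl
      exact this
    have hDW : ∀ x ∈ D.toSubgroup, x ∈ W → x = 1 := by
      intro x hx hxW
      have : (⟨x, hx⟩ : D.toSubgroup) ∈ Subtype.val ⁻¹' W := hxW
      rw [hW1, mem_singleton_iff, Subgroup.mk_eq_one] at this
      exact this
    refine ⟨fun x hx O hO => Eventually.of_forall fun r => ⟨1, one_mem (dilate D r).toSubgroup, ?_⟩,
      fun x hx => ?_⟩
    · rw [← mem_closedBot.1 hx]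
      exact mem_of_mem_nhds hO
    · have hx1 : x ≠ 1 := hx
      have hc : Tendsto (fun q : ℝ × Heisenberg => dilation q.1 q.2) (𝓝 0 ×ˢ 𝓝 x) (𝓝 1) := by
        have h := continuous_dilation.tendsto ((0 : ℝ), x)
        have e : dilation 0 x = 1 := by
          apply Heisenberg.ext <;> simp [dilation_apply]
        rw [nhds_prod_eq] at h
        simpa only [e] using h
      obtain ⟨A, hA, O, hO, hAO⟩ := Filter.mem_prod_iff.1 (hc (hW.mem_nhds h1W))
      refine ⟨O ∩ {1}ᶜ, inter_mem hO (isOpen_compl_singleton.mem_nhds hx1), ?_⟩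
      filter_upwards [hA] with r hr
      refine Set.disjoint_left.2 fun y hy hyO => hyO.2 ?_
      by_cases hr0 : r = 0
      · rw [hr0, dilate_zero] at hy
        exact mem_closedBot.1 hy
      · rw [coe_dilate hr0] at hy
        have h2 := hDW _ hy (hAO (Set.mk_mem_prod hr hyO.1))
        have h3 := dilation_dilation_inv (inv_ne_zero hr0) y
        rw [inv_inv, h2, map_one] at h3
        exact h3.symm
  · rw [coe_dilate hr₀]
    have hev : ∀ᶠ r : ℝ in 𝓝 r₀, r ≠ 0 := eventually_ne_nhds hr₀
    refine FellTendsto.congr' (FellTendsto.preimage_of_tendsto (l := 𝓝 r₀) D.isClosed'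
      (θ := fun r => dilation r) (θ' := fun r => dilation r⁻¹) (φ' := dilation r₀⁻¹)
      ?_ ?_ ?_ ?_) ?_
    · filter_upwards [hev] with r hr y
      exact dilation_dilation_inv hr y
    · intro x
      simpa using dilation_dilation_inv (inv_ne_zero hr₀) x
    · intro x
      rw [← nhds_prod_eq]
      exact continuous_dilation.tendsto (r₀, x)
    · intro y
      exact (continuous_dilation.tendsto (r₀⁻¹, y)).comp
        ((tendsto_inv₀ hr₀).prodMk_nhds tendsto_const_nhds)
    · filter_upwards [hev] with r hr
      exact (coe_dilate hr).symm

theorem joined_closedBot (D : ClosedSubgroup Heisenberg) : Joined D closedBot := by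
  by_cases h : ∀ a ∈ D.toSubgroup, ∀ b ∈ D.toSubgroup, area a.z b.z = 0
  · exact joined_closedBot_of_area_eq_zero h
  by_cases hT : centralPart D.toSubgroup = ⊤
  · exact joined_closedBot_of_centralPart_eq_top hT
  · push Not at h
    have hD : D ∈ lattices := mem_lattices_iff.2 ⟨h, hT⟩
    have := (continuous_dilate hD.1).joined_apply 1 0
    rwa [dilate_one, dilate_zero] at this

theorem pathConnectedSpace_closedSubgroup : PathConnectedSpace (ClosedSubgroup Heisenberg) where
  nonempty := ⟨closedBot⟩
  joined D D' := (joined_closedBot D).trans (joined_closedBot D').symm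

/-! ### Commutator index and conclusion -/

theorem z_eq_zero_of_mem_center {x : Heisenberg} (hx : x ∈ Subgroup.center Heisenberg) :
    x.z = 0 := by
  have h : ∀ g : Heisenberg, area g.z x.z = 0 := by
    intro g
    have h1 := congrArg Heisenberg.t (Subgroup.mem_center_iff.1 hx g)
    rw [mul_t', mul_t', area_swap g.z x.z] at h1
    linarith
  have h1 := h ⟨1, 0⟩
  have h2 := h ⟨Complex.I, 0⟩
  simp [area] at h1 h2
  exact Complex.ext h2 h1

theorem central_mem_center (t : ℝ) : central t ∈ Subgroup.center Heisenberg := by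
  refine Subgroup.mem_center_iff.2 fun g => ?_
  apply Heisenberg.ext
  · simp
  · rw [mul_t', mul_t']
    simp [area]
    ring

/-- An infinite index is encoded as `0`, so this is finiteness. The central subgroup is infinite
cyclic, and the single commutator of `a` and `b` already generates a subgroup of index `|k|` in it,
so the commutator subgroup need not be computed. -/
theorem relIndex_commutator_ne_zero {D : ClosedSubgroup Heisenberg} (hD : D ∈ lattices) :
    (⁅D.toSubgroup, D.toSubgroup⁆).relIndex (D.toSubgroup ⊓ Subgroup.center Heisenberg) ≠ 0 := by
  obtain ⟨a, b, c, k, h, hc, hT, hk⟩ := exists_isPlaneBasis_of_mem_lattices hD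
  have hk0 : k ≠ 0 := by
    rintro rfl
    exact h.2.2.1 (by simpa using hk)
  let f : Multiplicative ℤ →* Heisenberg := zpowersHom Heisenberg (central c)
  have hf : ∀ n : ℤ, f (Multiplicative.ofAdd n) = central (n * c) := by
    intro n
    apply Heisenberg.ext
    · simp [f, zpow_z]
    · simp [f, zpow_t]
  have hrange : D.toSubgroup ⊓ Subgroup.center Heisenberg = f.range := by
    ext x
    constructor
    · rintro ⟨hx, hx'⟩
      have hz := z_eq_zero_of_mem_center hx'
      have ht : x.t ∈ centralPart D.toSubgroup := by
        rw [mem_centralPart, ← eq_central hz]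
        exact hx
      rw [hT, AddSubgroup.mem_zmultiples_iff] at ht
      obtain ⟨n, hn⟩ := ht
      refine ⟨Multiplicative.ofAdd n, ?_⟩
      rw [hf, ← zsmul_eq_mul, hn, ← eq_central hz]
    · rintro ⟨n, rfl⟩
      rw [← ofAdd_toAdd n, hf]
      refine ⟨?_, central_mem_center _⟩
      refine mem_centralPart.1 ?_
      rw [hT, ← zsmul_eq_mul]
      exact AddSubgroup.zsmul_mem_zmultiples _ _
  rw [hrange, ← Subgroup.index_comap]
  have hle : AddSubgroup.toSubgroup (AddSubgroup.zmultiples k) ≤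
      (⁅D.toSubgroup, D.toSubgroup⁆).comap f := by
    intro n hn
    obtain ⟨m, hm⟩ := AddSubgroup.mem_zmultiples_iff.1
      (show n.toAdd ∈ AddSubgroup.zmultiples k from hn)
    have hcomm : f (Multiplicative.ofAdd k) ∈ ⁅D.toSubgroup, D.toSubgroup⁆ := by
      rw [hf, ← hk, ← commutator_eq]
      exact Subgroup.commutator_mem_commutator h.1 h.2.1
    have e : n = Multiplicative.ofAdd k ^ m := by
      rw [← ofAdd_zsmul, hm, ofAdd_toAdd]
    rw [Subgroup.mem_comap, e, map_zpow]
    exact zpow_mem hcomm m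
  refine ne_zero_of_dvd_ne_zero ?_ (Subgroup.index_dvd_of_le hle)
  rw [AddSubgroup.index_toSubgroup, Int.index_zmultiples]
  simpa using hk0

theorem lattices_eq_iUnion : lattices = ⋃ n ∈ Set.Ici 1, latticesOfIndex n := by
  ext D
  simp only [Set.mem_iUnion]
  constructor
  · intro hD
    exact ⟨_, Nat.one_le_iff_ne_zero.2 (relIndex_commutator_ne_zero hD), hD, rfl⟩
  · rintro ⟨n, -, hD⟩
    exact hD.1

theorem latticesInfty_subset_frontier : latticesInfty ⊆ frontier lattices := by
  intro D hD
  rw [isOpen_lattices.frontier_eq]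
  exact ⟨dense_lattices D, fun h => (mem_lattices_iff.1 h).2 (mem_latticesInfty_iff.1 hD).1⟩

theorem nonempty_latticesInfty : latticesInfty.Nonempty := by
  let β := Complex.basisOneI
  refine ⟨tube (gridSubgroup β 1) (isClosed_gridSubgroup β 1), mem_latticesInfty_iff.2
    ⟨?_, ⟨β 0, 0⟩, ⟨β 1, 0⟩, ?_, ?_, area_basis_ne_zero β, fun x hx => ?_⟩⟩
  · ext t
    simp only [mem_centralPart, mem_tube, central_z, AddSubgroup.mem_top, iff_true]
    exact zero_mem _
  · exact mem_tube.2 (mem_gridSubgroup_one.2 ⟨1, 0, by simp⟩)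
  · exact mem_tube.2 (mem_gridSubgroup_one.2 ⟨0, 1, by simp⟩)
  · obtain ⟨m, n, hmn⟩ := mem_gridSubgroup_one.1 (mem_tube.1 hx)
    exact ⟨m, n, by simpa [Complex.real_smul] using hmn⟩

theorem not_locallyConnectedSpace : ¬ LocallyConnectedSpace (ClosedSubgroup Heisenberg) := by
  intro h
  obtain ⟨C, hC⟩ := nonempty_latticesInfty
  obtain ⟨U, hU, ho, hCU, hconn⟩ := locallyConnectedSpace_iff_subsets_isOpen_isConnected.1 h C
    latticesBangBang (isOpen_latticesBangBang.mem_nhds (Or.inr hC))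
  exact not_isConnected_of_mem_nhds hC (dense_lattices C) (ho.mem_nhds hCU) hU hconn

end Heisenberg

theorem proposition8p5 :
    -- the frontier of the set of lattices, which is the union of the strata `n ≥ 1`
    (Heisenberg.lattices = ⋃ n ∈ Set.Ici 1, Heisenberg.latticesOfIndex n) ∧
    Heisenberg.latticesInfty ⊆ frontier Heisenberg.lattices ∧
    -- failure of local connectedness
    ¬ LocallyConnectedSpace (ClosedSubgroup Heisenberg) ∧
    (∀ C ∈ Heisenberg.latticesInfty, ∀ U ∈ 𝓝 C,
      U ⊆ Heisenberg.latticesBangBang → ¬ IsConnected U) ∧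
    -- openness and density
    IsOpen Heisenberg.lattices ∧ Dense Heisenberg.lattices ∧
    IsOpen Heisenberg.latticesBangBang ∧ Dense Heisenberg.latticesBangBang ∧
    -- path-connectedness
    PathConnectedSpace (ClosedSubgroup Heisenberg) :=
  ⟨Heisenberg.lattices_eq_iUnion, Heisenberg.latticesInfty_subset_frontier,
    Heisenberg.not_locallyConnectedSpace,
    fun _ hC _ hU hUL =>
      Heisenberg.not_isConnected_of_mem_nhds hC (Heisenberg.dense_lattices _) hU hUL,
    Heisenberg.isOpen_lattices, Heisenberg.dense_lattices, Heisenberg.isOpen_latticesBangBang,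
    Heisenberg.dense_lattices.mono Set.subset_union_left,
    Heisenberg.pathConnectedSpace_closedSubgroup⟩
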